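/- Conventions. "Definable" without a specified parameter set means definable with parameters. If $M$ and $N$ are structures with the same universe $G$, then $M$ is a \emph{reduct} of $N$, and $N$ an \emph{expansion} of $M$, if every subset of a finite power $G^k$ that is $\emptyset$-definable in $M$ is definable (with parameters from $G$) in $N$. An ordered abelian group is archimedean if for all $a$ and all $b>0$ there is $n\in\mathbb N$ with $a\le nb$; an abelian group $H$ has small quotients if $nH$ has finite index in $H$ for every $n\ge 1$. A structure is stable if its complete theory is stable, i.e. no formula has the order property. Statement. Let $N=(G,+,<)$ be elementarily equivalent to an archimedean ordered abelian group with small quotients, and let $M$ be a structure, in some language $L$, that is a reduct (not necessarily over $\emptyset$) of $N$ and an expansion of $(G,+)$. Let $\mathcal N=(\mathcal G,+,<)$ be a monster model of $\mathrm{Th}(N)$ containing $N$ as a small elementary substructure: $N\prec\mathcal N$, and $\mathcal N$ is $\kappa$-saturated and strongly $\kappa$-homogeneous for some infinite cardinal $\kappa>|G|$. Let $\mathcal M$ be the reduct of $\mathcal N$ to the language of $M$, i.e. the $L$-structure on $\mathcal G$ in which each symbol of $L$ is interpreted by the same $\{+,<\}$-formula with parameters from $G$ that defines its interpretation in $M$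 (by elementarity it does not matter which such formula is used). Then the following are equivalent: 1. $M$ is stable. 2. Every subset $D\subseteq G$ that is definable in $M$ is also definable in $(G,+)$. 3. Every subset $\mathcal D\subseteq\mathcal G$ that is definable in $\mathcal M$ is also definable in $(\mathcal G,+)$. -/

import Mathlib

open FirstOrder FirstOrder.Language Cardinal

/-! ### The languages of `(G, +)` and `(G, +, <)` -/

/-- The only function symbol: a binary `+`. -/
inductive PlusFunc : ℕ → Type
  | add : PlusFunc 2

/-- The only relation symbol: a binary `<`. -/
inductive LessRel : ℕ → Type
  | lt : LessRel 2

/-- The language `{+}`. -/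
def groupLang : FirstOrder.Language.{0, 0} := ⟨PlusFunc, fun _ => Empty⟩

/-- The language `{+, <}`. -/
def ordGroupLang : FirstOrder.Language.{0, 0} := ⟨PlusFunc, LessRel⟩

/-- The structure `(G, +)`. -/
instance groupStructure (G : Type*) [Add G] : groupLang.Structure G where
  funMap {_} s := match s with
    | PlusFunc.add => fun x => x 0 + x 1
  RelMap {_} r := nomatch r

/-- The structure `(G, +, <)`. -/
instance ordGroupStructure (G : Type*) [Add G] [LT G] : ordGroupLang.Structure G where
  funMap {_} s := match s with
    | PlusFunc.add => fun x => x 0 + x 1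
  RelMap {_} r := match r with
    | LessRel.lt => fun x => x 0 < x 1

/-- An abelian group has small quotients if `nH` has finite index in `H` for all `n ≥ 1`. -/
def HasSmallQuotients (H : Type*) [AddCommGroup H] : Prop :=
  ∀ n : ℕ, 1 ≤ n → (nsmulAddMonoidHom n : H →+ H).range.FiniteIndex

/-! ### Reducts, unary definable sets, stability -/

/-- For an `L₁`-structure and an `L₂`-structure on the same universe `M` and `A ⊆ M`: the first is
an `A`-reduct of the second (and the second is an `A`-expansion of the first), i.e. every set that
is `∅`-definable in the first is `A`-definable in the second. -/
def IsReductOver {M : Type*} (A : Set M) (L₁ L₂ : FirstOrder.Language)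
    [L₁.Structure M] [L₂.Structure M] : Prop :=
  ∀ (k : ℕ) (X : Set (Fin k → M)), (∅ : Set M).Definable L₁ X → A.Definable L₂ X

/-- Every subset of `M` that is definable (with parameters) in the `L`-structure `M` is also
definable (with parameters) in the `L₀`-structure `M`. -/
def NoNewUnarySets (L₀ L : FirstOrder.Language) (M : Type*)
    [L₀.Structure M] [L.Structure M] : Prop :=
  ∀ D : Set M, (Set.univ : Set M).Definable₁ L D → (Set.univ : Set M).Definable₁ L₀ D

/-- `M` is stable: no formula `φ(x, y)`, with `x` and `y` finite tuples of variables, has the order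
property in the complete theory of `M`, i.e. none has ladders of every finite length in `M`. -/
def IsStableStructure (L : FirstOrder.Language) (M : Type*) [L.Structure M] : Prop :=
  ∀ (m n : ℕ) (φ : L.Formula (Fin m ⊕ Fin n)), ∃ k : ℕ,
    ¬ ∃ (a : Fin k → Fin m → M) (b : Fin k → Fin n → M),
      ∀ i j : Fin k, φ.Realize (Sum.elim (a i) (b j)) ↔ i < j

/-! ### Monster models -/

/-- `M` is `κ`-saturated: for every `A ⊆ M` with `|A| < κ`, every set of formulas over `A` in one
variable that is finitely satisfiable in `M` is realized in `M`. -/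
def IsSaturatedAt (κ : Cardinal) (L : FirstOrder.Language) (M : Type*) [L.Structure M] : Prop :=
  ∀ A : Set M, #A < κ → ∀ p : Set (L[[A]].Formula (Fin 1)),
    (∀ s : Finset (L[[A]].Formula (Fin 1)), ↑s ⊆ p →
      ∃ c : M, ∀ φ ∈ s, φ.Realize (fun _ => c)) →
    ∃ c : M, ∀ φ ∈ p, φ.Realize (fun _ => c)

/-- `M` is strongly `κ`-homogeneous: every partial elementary map from a set of size `< κ` to `M`
extends to an automorphism of `M`. -/
def IsStronglyHomogeneousAt (κ : Cardinal) (L : FirstOrder.Language) (M : Type*)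
    [L.Structure M] : Prop :=
  ∀ A : Set M, #A < κ → ∀ g : A → M,
    (∀ φ : L.Formula A, φ.Realize (fun a : A => (a : M)) ↔ φ.Realize g) →
    ∃ σ : M ≃[L] M, ∀ a : A, σ a = g a

/-- `M` is a monster model (of its complete theory) with respect to the infinite cardinal `κ`, the
sets of size `< κ` being the small ones. -/
def IsMonsterModel (κ : Cardinal) (L : FirstOrder.Language) (M : Type*) [L.Structure M] : Prop :=
  ℵ₀ ≤ κ ∧ IsSaturatedAt κ L M ∧ IsStronglyHomogeneousAt κ L M

/-! ### The reduct of an elementary extension to the language of a reduct -/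

/-- Let `f : N ↪ₑ N'` be an elementary embedding of `L'`-structures, and let `M` be an `L`-structure
with the same universe `G` as `N` which is a reduct of `N`, possibly with parameters. Then each
symbol of `L` is interpreted in `M` by an `L'`-formula `θ` with parameters from `G`; in the reduct of
`N'` to the language `L` it is interpreted by the same formula, its parameters being moved by `f`.
(By elementarity, the choice of `θ` does not matter, and for a function symbol `θ` defines the graph
of a function on `N'` again.) -/
@[reducible] noncomputable def reductStructure (L : FirstOrder.Language)
    {L' : FirstOrder.Language} {G G' : Type*} [L.Structure G] [L'.Structure G] [L'.Structure G'] [Nonempty G'] (f : G ↪ₑ[L'] G') :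
    L.Structure G' where
  funMap {n} F x := Classical.epsilon fun y : G' =>
    ∃ θ : L'.Formula (G ⊕ Fin (n + 1)),
      (∀ (v : Fin n → G) (w : G),
        θ.Realize (Sum.elim id (Fin.snoc v w : Fin (n + 1) → G)) ↔ Structure.funMap F v = w) ∧
      θ.Realize (Sum.elim f (Fin.snoc x y : Fin (n + 1) → G'))
  RelMap {n} R x :=
    ∃ θ : L'.Formula (G ⊕ Fin n),
      (∀ v : Fin n → G, θ.Realize (Sum.elim id v) ↔ Structure.RelMap R v) ∧
      θ.Realize (Sum.elim f x)

/-!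
An archimedean ordered group is regular: every interval `[x, x + m • w]` with `0 < w` meets `mG`.
This can be expressed by first-order sentences, and it yields quantifier elimination: truth of a
formula of `(G, +, <)` at a tuple depends only on the signs of finitely many affine functions of it
and on its class modulo some `n`. Consequently, for an `L`-definable `D`, each set
`{y | c + n • y ∈ D}` is determined by the signs of finitely many affine functions of `y`.

Each of the three conditions forces an `L`-definable set `E` that is determined by signs to be
finite or cofinite. Otherwise there are arbitrarily long arithmetic progressions, extending to both
sides of a point, of which exactly the part above that point lies in `E` (or exactly the part below
it), so that `x + y ∈ E` has the order property. Moreover `{y | m • y ∈ E}` is then infinite and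
coinfinite for all `0 < m`, whereas for a set definable in `(G, +)` it is finite or cofinite for
some `m`, again by quantifier elimination.

The bound on the size of the finite sets is uniform in families. If the order is dense, a finite set
has at most one point per sign pattern. If it is discrete with least positive element `u`, a finite
set has at most one run of step `u` per sign pattern, and if runs could be arbitrarily long, then
`{i • u | i ∈ ℕ}` would be definable, although it is neither finite nor cofinite on a coset of `nG`.

Such a uniform bound is a first-order property, so it passes to `𝒢`. It implies that a definable set
is finite or cofinite on each of finitely many cosets, hence definable in `(G, +)`. It also implies
stability: by induction on `m`, definable relations between `m`-tuples and tuples have no long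
ladders. After passing to a coset, the first coordinate of the `m`-tuple ranges over fibers of
bounded size or their complements. A long ladder contains, by Ramsey's theorem, one on which the
fibers over a fixed parameter are small and contain these coordinates. For a further parameter,
either the fiber over it contains these small sets, which is a relation between fewer coordinates,
or intersecting with it makes them smaller.
-/

/-! ### Simultaneous definability in two structures -/

section CoDefinable

variable {L₁ : FirstOrder.Language} {C G G' : Type*} [L₁.Structure G] [L₁.Structure G']

/-- The formula `θ`, with its parameters `C` interpreted by `f`, defines the relation `P`. -/
def Defines {L₁ : FirstOrder.Language} {C G α : Type*} [L₁.Structure G] (θ : L₁.Formula (C ⊕ α))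
    (f : C → G) (P : (α → G) → Prop) : Prop :=
  ∀ v, θ.Realize (Sum.elim f v) ↔ P v

/-- One formula with parameters from `C` defines `P` in `G` and `P'` in `G'`, where `f` and `f'`
interpret the parameters. Any statement built from such relations is transferred between `G` and
`G'` when these are elementarily equivalent over `C`. -/
def CoDefinable (L₁ : FirstOrder.Language) {C G G' : Type*} [L₁.Structure G] [L₁.Structure G']
    (f : C → G) (f' : C → G') {α : Type*} (P : (α → G) → Prop) (P' : (α → G') → Prop) : Prop :=
  ∃ θ : L₁.Formula (C ⊕ α), Defines θ f P ∧ Defines θ f' P'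

/-- One formula defines the graph of `F` in `G` and the graph of `F'` in `G'`; the value is the
variable `none`. -/
def CoDefinableFun (L₁ : FirstOrder.Language) {C G G' : Type*} [L₁.Structure G] [L₁.Structure G']
    (f : C → G) (f' : C → G') {α : Type*} (F : (α → G) → G) (F' : (α → G') → G') : Prop :=
  CoDefinable L₁ f f' (fun w : Option α → G => w none = F fun i => w (some i))
    (fun w : Option α → G' => w none = F' fun i => w (some i))

/-- One formula defines the family of sets `S v` in `G` and the family `S' v` in `G'`; the element
of the set is the variable `none`. -/
def CoDefinableFamily (L₁ : FirstOrder.Language) {C G G' : Type*} [L₁.Structure G]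
    [L₁.Structure G'] (f : C → G) (f' : C → G') {α : Type*} (S : (α → G) → Set G)
    (S' : (α → G') → Set G') : Prop :=
  CoDefinable L₁ f f' (fun w : Option α → G => w none ∈ S fun i => w (some i))
    (fun w : Option α → G' => w none ∈ S' fun i => w (some i))

variable {f : C → G} {f' : C → G'} {α β γ : Type*}
  {P Q : (α → G) → Prop} {P' Q' : (α → G') → Prop}

theorem Defines.congr {θ : L₁.Formula (C ⊕ α)} (h : Defines θ f P) (hPQ : ∀ v, P v ↔ Q v) :
    Defines θ f Q :=
  fun v => (h v).trans (hPQ v)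

theorem Defines.not {θ : L₁.Formula (C ⊕ α)} (h : Defines θ f P) :
    Defines θ.not f fun v => ¬ P v :=
  fun v => Formula.realize_not.trans (not_congr (h v))

theorem Defines.imp {θ η : L₁.Formula (C ⊕ α)} (hθ : Defines θ f P) (hη : Defines η f Q) :
    Defines (θ.imp η) f fun v => P v → Q v :=
  fun v => Formula.realize_imp.trans (imp_congr (hθ v) (hη v))

theorem Defines.iInf {ι : Type*} [Finite ι] {θ : ι → L₁.Formula (C ⊕ α)}
    {P : ι → (α → G) → Prop} (h : ∀ i, Defines (θ i) f (P i)) :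
    Defines (Formula.iInf θ) f fun v => ∀ i, P i v :=
  fun v => Formula.realize_iInf.trans (forall_congr' fun i => h i v)

theorem Defines.relabel {θ : L₁.Formula (C ⊕ β)} {P : (β → G) → Prop} (h : Defines θ f P)
    (e : β → C ⊕ α) :
    Defines (θ.relabel (Sum.elim Sum.inl e)) f fun v => P fun i => Sum.elim f v (e i) := by
  intro v
  rw [Formula.realize_relabel, Sum.comp_elim, Sum.elim_comp_inl]
  exact h _

theorem Defines.iExs [Finite β] {θ : L₁.Formula (C ⊕ (α ⊕ β))} {P : (α → G) → (β → G) → Prop}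
    (h : Defines θ f fun w => P (fun i => w (Sum.inl i)) fun i => w (Sum.inr i)) :
    Defines (Formula.iExs β (θ.relabel (Equiv.sumAssoc C α β).symm)) f fun v => ∃ u, P v u := by
  intro v
  rw [Formula.realize_iExs]
  refine exists_congr fun u => ?_
  have hassoc : Sum.elim (Sum.elim f v) u ∘ (Equiv.sumAssoc C α β).symm =
      Sum.elim f (Sum.elim v u) := by
    ext (_ | _ | _) <;> rfl
  rw [Formula.realize_relabel, hassoc]
  exact h (Sum.elim v u)

theorem CoDefinable.congr (h : CoDefinable L₁ f f' P P') (hPQ : ∀ v, P v ↔ Q v)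
    (hPQ' : ∀ v, P' v ↔ Q' v) : CoDefinable L₁ f f' Q Q' := by
  obtain ⟨θ, hP, hP'⟩ := h
  exact ⟨θ, hP.congr hPQ, hP'.congr hPQ'⟩

theorem CoDefinable.not (h : CoDefinable L₁ f f' P P') :
    CoDefinable L₁ f f' (fun v => ¬ P v) (fun v => ¬ P' v) := by
  obtain ⟨θ, hP, hP'⟩ := h
  exact ⟨_, hP.not, hP'.not⟩

theorem CoDefinable.imp (h : CoDefinable L₁ f f' P P') (h' : CoDefinable L₁ f f' Q Q') :
    CoDefinable L₁ f f' (fun v => P v → Q v) (fun v => P' v → Q' v) := by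
  obtain ⟨θ, hP, hP'⟩ := h
  obtain ⟨η, hQ, hQ'⟩ := h'
  exact ⟨_, hP.imp hQ, hP'.imp hQ'⟩

theorem CoDefinable.and (h : CoDefinable L₁ f f' P P') (h' : CoDefinable L₁ f f' Q Q') :
    CoDefinable L₁ f f' (fun v => P v ∧ Q v) (fun v => P' v ∧ Q' v) :=
  (h.imp h'.not).not.congr (fun _ => by tauto) (fun _ => by tauto)

theorem CoDefinable.or (h : CoDefinable L₁ f f' P P') (h' : CoDefinable L₁ f f' Q Q') :
    CoDefinable L₁ f f' (fun v => P v ∨ Q v) (fun v => P' v ∨ Q' v) :=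
  (h.not.imp h').congr (fun _ => by tauto) (fun _ => by tauto)

theorem CoDefinable.false : CoDefinable L₁ f f' (fun _ : α → G => False) (fun _ => False) :=
  ⟨⊥, fun _ => Iff.rfl, fun _ => Iff.rfl⟩

theorem CoDefinable.finite_forall {ι : Type*} [Finite ι] {P : ι → (α → G) → Prop}
    {P' : ι → (α → G') → Prop} (h : ∀ i, CoDefinable L₁ f f' (P i) (P' i)) :
    CoDefinable L₁ f f' (fun v => ∀ i, P i v) (fun v => ∀ i, P' i v) := by
  choose θ hP hP' using h
  exact ⟨_, Defines.iInf hP, Defines.iInf hP'⟩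

theorem CoDefinable.finite_exists {ι : Type*} [Finite ι] {P : ι → (α → G) → Prop}
    {P' : ι → (α → G') → Prop} (h : ∀ i, CoDefinable L₁ f f' (P i) (P' i)) :
    CoDefinable L₁ f f' (fun v => ∃ i, P i v) (fun v => ∃ i, P' i v) :=
  (CoDefinable.finite_forall fun i => (h i).not).not.congr (fun _ => by simp) (fun _ => by simp)

theorem CoDefinable.prop (p : Prop) :
    CoDefinable L₁ f f' (fun _ : α → G => p) (fun _ => p) := by
  by_cases hp : p
  · simpa only [hp, not_false_eq_true] using CoDefinable.false.not
  · simpa only [hp] using CoDefinable.false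

theorem CoDefinable.reindex {P : (β → G) → Prop} {P' : (β → G') → Prop}
    (h : CoDefinable L₁ f f' P P') (e : β → C ⊕ α) :
    CoDefinable L₁ f f' (fun v => P fun i => Sum.elim f v (e i))
      (fun v => P' fun i => Sum.elim f' v (e i)) := by
  obtain ⟨θ, hP, hP'⟩ := h
  exact ⟨_, hP.relabel e, hP'.relabel e⟩

theorem CoDefinable.relabel {P : (β → G) → Prop} {P' : (β → G') → Prop}
    (h : CoDefinable L₁ f f' P P') (e : β → α) :
    CoDefinable L₁ f f' (fun v => P fun i => v (e i)) (fun v => P' fun i => v (e i)) :=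
  h.reindex fun i => Sum.inr (e i)

theorem CoDefinable.exists_tuple [Finite β] {P : (α → G) → (β → G) → Prop}
    {P' : (α → G') → (β → G') → Prop}
    (h : CoDefinable L₁ f f'
      (fun w : α ⊕ β → G => P (fun i => w (Sum.inl i)) fun i => w (Sum.inr i))
      (fun w : α ⊕ β → G' => P' (fun i => w (Sum.inl i)) fun i => w (Sum.inr i))) :
    CoDefinable L₁ f f' (fun v => ∃ u, P v u) (fun v => ∃ u, P' v u) := by
  obtain ⟨θ, hP, hP'⟩ := h
  exact ⟨_, hP.iExs, hP'.iExs⟩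

theorem CoDefinable.forall_tuple [Finite β] {P : (α → G) → (β → G) → Prop}
    {P' : (α → G') → (β → G') → Prop}
    (h : CoDefinable L₁ f f'
      (fun w : α ⊕ β → G => P (fun i => w (Sum.inl i)) fun i => w (Sum.inr i))
      (fun w : α ⊕ β → G' => P' (fun i => w (Sum.inl i)) fun i => w (Sum.inr i))) :
    CoDefinable L₁ f f' (fun v => ∀ u, P v u) (fun v => ∀ u, P' v u) :=
  (CoDefinable.exists_tuple (P := fun v u => ¬ P v u) (P' := fun v u => ¬ P' v u) h.not).not.congr
    (fun _ => by simp) (fun _ => by simp)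

theorem CoDefinable.exists {P : (α → G) → G → Prop} {P' : (α → G') → G' → Prop}
    (h : CoDefinable L₁ f f' (fun w : Option α → G => P (fun i => w (some i)) (w none))
      (fun w : Option α → G' => P' (fun i => w (some i)) (w none))) :
    CoDefinable L₁ f f' (fun v => ∃ x, P v x) (fun v => ∃ x, P' v x) :=
  (CoDefinable.exists_tuple (β := Unit) (P := fun v u => P v (u ()))
    (P' := fun v u => P' v (u ())) (h.relabel fun o => o.elim (Sum.inr ()) Sum.inl)).congr
    (fun _ => (Equiv.funUnique Unit G).exists_congr fun _ => Iff.rfl)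
    (fun _ => (Equiv.funUnique Unit G').exists_congr fun _ => Iff.rfl)

theorem CoDefinable.forall {P : (α → G) → G → Prop} {P' : (α → G') → G' → Prop}
    (h : CoDefinable L₁ f f' (fun w : Option α → G => P (fun i => w (some i)) (w none))
      (fun w : Option α → G' => P' (fun i => w (some i)) (w none))) :
    CoDefinable L₁ f f' (fun v => ∀ x, P v x) (fun v => ∀ x, P' v x) :=
  (CoDefinable.exists (P := fun v u => ¬ P v u) (P' := fun v u => ¬ P' v u) h.not).not.congr
    (fun _ => by simp) (fun _ => by simp)

theorem CoDefinable.var_eq_var (i j : C ⊕ α) :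
    CoDefinable L₁ f f' (fun v : α → G => Sum.elim f v i = Sum.elim f v j)
      (fun v => Sum.elim f' v i = Sum.elim f' v j) :=
  ⟨Term.equal (Term.var i) (Term.var j), fun _ => Formula.realize_equal,
    fun _ => Formula.realize_equal⟩

theorem CoDefinableFun.proj (i : α) :
    CoDefinableFun L₁ f f' (fun v : α → G => v i) (fun v : α → G' => v i) :=
  CoDefinable.var_eq_var (.inr none) (.inr (some i))

theorem CoDefinableFun.const (c : C) :
    CoDefinableFun L₁ f f' (fun _ : α → G => f c) (fun _ : α → G' => f' c) :=
  CoDefinable.var_eq_var (.inr none) (.inl c)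

theorem CoDefinable.comp [Finite β] {P : (β → G) → Prop} {P' : (β → G') → Prop}
    (h : CoDefinable L₁ f f' P P') {F : β → (α → G) → G} {F' : β → (α → G') → G'}
    (hF : ∀ i, CoDefinableFun L₁ f f' (F i) (F' i)) :
    CoDefinable L₁ f f' (fun v => P fun i => F i v) (fun v => P' fun i => F' i v) := by
  have h₁ := CoDefinable.exists_tuple (α := α) (β := β) (P := fun v u => (∀ i, u i = F i v) ∧ P u)
    (P' := fun v u => (∀ i, u i = F' i v) ∧ P' u)
    ((CoDefinable.finite_forall fun i =>
      (hF i).relabel (fun o => o.elim (Sum.inr i) Sum.inl)).and (h.relabel Sum.inr))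
  exact h₁.congr (fun v => by simp only [← funext_iff, exists_eq_left])
    (fun v => by simp only [← funext_iff, exists_eq_left])

theorem CoDefinableFun.comp [Finite β] {E : (β → G) → G} {E' : (β → G') → G'}
    (h : CoDefinableFun L₁ f f' E E') {F : β → (α → G) → G} {F' : β → (α → G') → G'}
    (hF : ∀ i, CoDefinableFun L₁ f f' (F i) (F' i)) :
    CoDefinableFun L₁ f f' (fun v => E fun i => F i v) (fun v => E' fun i => F' i v) :=
  CoDefinable.comp h (F := fun o => o.elim (fun w => w none) fun i w => F i fun j => w (some j))
    (F' := fun o => o.elim (fun w => w none) fun i w => F' i fun j => w (some j)) <| by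
      rintro (_ | i)
      · exact CoDefinableFun.proj none
      · exact (hF i).relabel (fun o => o.elim none fun j => some (some j))

theorem CoDefinableFun.relabel {F : (β → G) → G} {F' : (β → G') → G'}
    (h : CoDefinableFun L₁ f f' F F') (e : β → α) :
    CoDefinableFun L₁ f f' (fun v => F fun i => v (e i)) (fun v => F' fun i => v (e i)) :=
  CoDefinable.relabel h (Option.map e)

theorem CoDefinable.eq {F E : (α → G) → G} {F' E' : (α → G') → G'}
    (hF : CoDefinableFun L₁ f f' F F') (hE : CoDefinableFun L₁ f f' E E') :
    CoDefinable L₁ f f' (fun v => F v = E v) (fun v => F' v = E' v) :=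
  (CoDefinable.exists (P := fun v x => x = F v ∧ x = E v) (P' := fun v x => x = F' v ∧ x = E' v)
    (hF.and hE)).congr (fun _ => exists_eq_left) (fun _ => exists_eq_left)

theorem CoDefinableFamily.mem {S : (β → G) → Set G} {S' : (β → G') → Set G'} [Finite β]
    {F : (α → G) → G} {F' : (α → G') → G'} (h : CoDefinableFamily L₁ f f' S S')
    {v : β → (α → G) → G} {v' : β → (α → G') → G'} (hF : CoDefinableFun L₁ f f' F F')
    (hv : ∀ i, CoDefinableFun L₁ f f' (v i) (v' i)) :
    CoDefinable L₁ f f' (fun w => F w ∈ S fun i => v i w) (fun w => F' w ∈ S' fun i => v' i w) :=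
  CoDefinable.comp h (F := fun o => o.elim F v) (F' := fun o => o.elim F' v') <| by
    rintro (_ | i)
    exacts [hF, hv i]

theorem CoDefinableFamily.mem_comp {S : (β → G) → Set G} {S' : (β → G') → Set G'} [Finite β]
    {F : (α → G) → G} {F' : (α → G') → G'} (h : CoDefinableFamily L₁ f f' S S') (e : β → α)
    (hF : CoDefinableFun L₁ f f' F F') :
    CoDefinable L₁ f f' (fun w => F w ∈ S fun i => w (e i))
      (fun w => F' w ∈ S' fun i => w (e i)) :=
  h.mem hF fun i => CoDefinableFun.proj (e i)

theorem CoDefinableFamily.compl {S : (α → G) → Set G} {S' : (α → G') → Set G'}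
    (h : CoDefinableFamily L₁ f f' S S') :
    CoDefinableFamily L₁ f f' (fun v => (S v)ᶜ) (fun v => (S' v)ᶜ) :=
  h.not

theorem not_encard_le_natCast_iff {S : Set G} {k : ℕ} :
    ¬ S.encard ≤ k ↔ ∃ x : Fin (k + 1) → G, Function.Injective x ∧ ∀ i, x i ∈ S := by
  have hembedding : ¬ S.encard ≤ k ↔ Nonempty (Fin (k + 1) ↪ S) := by
    rw [not_le, ← ENat.add_one_le_iff (ENat.natCast_ne_top k), ← Nat.cast_add_one, Set.encard,
      ENat.card, Cardinal.natCast_le_toENat, ← Cardinal.lift_mk_fin, ← Cardinal.lift_id'.{0} #S,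
      Cardinal.lift_mk_le']
  rw [hembedding]
  exact ⟨fun ⟨x⟩ => ⟨fun i => x i, Subtype.val_injective.comp x.injective, fun i => (x i).2⟩,
    fun ⟨x, hinj, hx⟩ => ⟨⟨fun i => ⟨x i, hx i⟩, fun i j h => hinj (congrArg Subtype.val h)⟩⟩⟩

theorem CoDefinableFamily.encard_le {S : (α → G) → Set G} {S' : (α → G') → Set G'}
    (h : CoDefinableFamily L₁ f f' S S') (k : ℕ) :
    CoDefinable L₁ f f' (fun v => (S v).encard ≤ k) (fun v => (S' v).encard ≤ k) := by
  have hmany : CoDefinable L₁ f f'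
      (fun v => ∃ x : Fin (k + 1) → G, Function.Injective x ∧ ∀ i, x i ∈ S v)
      (fun v => ∃ x : Fin (k + 1) → G', Function.Injective x ∧ ∀ i, x i ∈ S' v) :=
    CoDefinable.exists_tuple <| CoDefinable.and
      (CoDefinable.finite_forall fun i => CoDefinable.finite_forall fun j =>
        (CoDefinable.eq (CoDefinableFun.proj (Sum.inr i)) (CoDefinableFun.proj (Sum.inr j))).imp
          (CoDefinable.prop (i = j)))
      (CoDefinable.finite_forall fun i =>
        h.relabel fun o : Option α => o.elim (Sum.inr i) Sum.inl)
  exact hmany.not.congr (fun v => not_iff_comm.1 not_encard_le_natCast_iff)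
    (fun v => not_iff_comm.1 not_encard_le_natCast_iff)

/-- The interpretations of the symbols of `L` are defined by `L₁`-formulas, the same in `G` and in
`G'`. -/
structure Interprets (L L₁ : FirstOrder.Language) {C G G' : Type*} [L.Structure G] [L.Structure G']
    [L₁.Structure G] [L₁.Structure G'] (f : C → G) (f' : C → G') : Prop where
  funMap : ∀ {n} (F : L.Functions n), CoDefinableFun L₁ f f' (fun v => Structure.funMap F v)
    (fun v => Structure.funMap F v)
  relMap : ∀ {n} (R : L.Relations n), CoDefinable L₁ f f' (fun v => Structure.RelMap R v)
    (fun v => Structure.RelMap R v)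

variable {L : FirstOrder.Language} [L.Structure G] [L.Structure G']

theorem Interprets.term (H : Interprets L L₁ f f') (t : L.Term α) :
    CoDefinableFun L₁ f f' (fun v => t.realize v) (fun v => t.realize v) := by
  induction t with
  | var i => exact CoDefinableFun.proj i
  | func F ts ih => exact (H.funMap F).comp ih

theorem Interprets.boundedFormula (H : Interprets L L₁ f f') {n : ℕ} (φ : L.BoundedFormula α n) :
    CoDefinable L₁ f f' (fun w : α ⊕ Fin n → G => φ.Realize (w ∘ Sum.inl) (w ∘ Sum.inr))
      (fun w => φ.Realize (w ∘ Sum.inl) (w ∘ Sum.inr)) := by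
  induction φ with
  | falsum => exact CoDefinable.false
  | equal t₁ t₂ =>
    refine (CoDefinable.eq (H.term t₁) (H.term t₂)).congr ?_ ?_ <;>
    · intro w
      change _ ↔ t₁.realize (Sum.elim (w ∘ Sum.inl) (w ∘ Sum.inr)) =
        t₂.realize (Sum.elim (w ∘ Sum.inl) (w ∘ Sum.inr))
      rw [Sum.elim_comp_inl_inr]
  | rel R ts =>
    refine ((H.relMap R).comp fun i => H.term (ts i)).congr ?_ ?_ <;>
    · intro w
      change _ ↔ Structure.RelMap R fun i =>
        (ts i).realize (Sum.elim (w ∘ Sum.inl) (w ∘ Sum.inr))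
      rw [Sum.elim_comp_inl_inr]
  | imp φ ψ hφ hψ => exact hφ.imp hψ
  | @all n φ ih =>
    have hsnoc := ih.relabel (α := Option (α ⊕ Fin n)) (Sum.elim (some ∘ Sum.inl)
      (Fin.snoc (α := fun _ => Option (α ⊕ Fin n)) (some ∘ Sum.inr) none))
    refine CoDefinable.forall (P := fun w x => φ.Realize (w ∘ Sum.inl) (Fin.snoc (w ∘ Sum.inr) x))
      (P' := fun w x => φ.Realize (w ∘ Sum.inl) (Fin.snoc (w ∘ Sum.inr) x)) (hsnoc.congr ?_ ?_) <;>
    · intro w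
      rw [← Function.comp_def, Function.comp_assoc, Function.comp_assoc, Sum.elim_comp_inr,
        Fin.comp_snoc]
      exact Iff.rfl

theorem Interprets.formula (H : Interprets L L₁ f f') (φ : L.Formula α) :
    CoDefinable L₁ f f' (fun w => φ.Realize w) (fun w => φ.Realize w) := by
  refine ((H.boundedFormula φ).relabel (Sum.elim id finZeroElim)).congr ?_ ?_ <;>
  · intro w
    rw [Formula.Realize]
    exact iff_of_eq (congrArg _ (Subsingleton.elim _ _))

end CoDefinable

/-! ### Transfer -/

section Transfer

variable {L₁ : FirstOrder.Language} {G G' : Type*} [L₁.Structure G] [L₁.Structure G']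

theorem CoDefinable.comp_iff_of_elementaryEmbedding {f : G ↪ₑ[L₁] G'} {α : Type*}
    {P : (α → G) → Prop} {P' : (α → G') → Prop} (h : CoDefinable L₁ id f P P') (v : α → G) :
    P' (f ∘ v) ↔ P v := by
  obtain ⟨θ, hP, hP'⟩ := h
  rw [← hP, ← hP', ← f.map_formula, Sum.comp_elim, Function.comp_id]

variable {P P' : Prop}

theorem CoDefinable.iff_of_elementaryEmbedding {f : G ↪ₑ[L₁] G'}
    (h : CoDefinable L₁ id f (fun _ : Empty → G => P) (fun _ : Empty → G' => P')) : P ↔ P' :=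
  (h.comp_iff_of_elementaryEmbedding Empty.elim).symm

theorem CoDefinable.iff_of_elementarilyEquivalent (e : G ≅[L₁] G')
    (h : CoDefinable L₁ (Empty.elim : Empty → G) (Empty.elim : Empty → G')
      (fun _ : Empty → G => P) (fun _ : Empty → G' => P')) : P ↔ P' := by
  obtain ⟨θ, hP, hP'⟩ := h
  have hsentence := e.realize_sentence (θ.relabel (Sum.elim id id))
  simp only [Sentence.Realize, Formula.realize_relabel] at hsentence
  refine (hP Empty.elim).symm.trans (Iff.trans ?_ (hP' Empty.elim))
  convert! hsentence <;> exact Subsingleton.elim _ _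

end Transfer

/-! ### Definability with parameters -/

section DefinableRel

variable {L : FirstOrder.Language} {G α β : Type*} [L.Structure G]

/-- The relation `P` is definable with parameters. This is the case of `CoDefinable` in which both
structures agree, so that the closure properties above apply. -/
abbrev DefinableRel (L : FirstOrder.Language) {G α : Type*} [L.Structure G]
    (P : (α → G) → Prop) : Prop :=
  CoDefinable L (id : G → G) (id : G → G) P P

/-- The graph of the function `F` is definable with parameters. -/
abbrev DefinableMap (L : FirstOrder.Language) {G α : Type*} [L.Structure G]
    (F : (α → G) → G) : Prop :=
  CoDefinableFun L (id : G → G) (id : G → G) F F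

/-- The sets `S v` form a family that is definable with parameters. -/
abbrev DefinableFamily (L : FirstOrder.Language) {G α : Type*} [L.Structure G]
    (S : (α → G) → Set G) : Prop :=
  CoDefinableFamily L (id : G → G) (id : G → G) S S

theorem Defines.definableRel {θ : L.Formula (G ⊕ α)} {P : (α → G) → Prop} (h : Defines θ id P) :
    DefinableRel L P :=
  ⟨θ, h, h⟩

theorem definableRel_iff_definable {P : (α → G) → Prop} :
    DefinableRel L P ↔ (Set.univ : Set G).Definable L {v | P v} := by
  rw [Set.definable_iff_exists_formula_sum]
  constructor
  · rintro ⟨θ, h, -⟩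
    refine ⟨θ.relabel (Sum.map (fun x => ⟨x, trivial⟩) id), Set.ext fun v => ?_⟩
    rw [Set.mem_ofPred_eq, Set.mem_ofPred_eq, Formula.realize_relabel, ← h, Sum.elim_comp_map]
    exact Iff.rfl
  · rintro ⟨φ, hφ⟩
    refine Defines.definableRel (θ := φ.relabel (Sum.map Subtype.val id)) fun v => ?_
    rw [Formula.realize_relabel, Sum.elim_comp_map]
    exact (Set.ext_iff.1 hφ v).symm

theorem definable₁_iff_definableRel {D : Set G} :
    (Set.univ : Set G).Definable₁ L D ↔ DefinableRel L fun v : Unit → G => v () ∈ D := by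
  rw [Set.Definable₁, ← definableRel_iff_definable]
  exact ⟨fun h => h.relabel fun _ => (), fun h => h.relabel fun _ => 0⟩

theorem DefinableRel.exists_params {P : (α → G) → Prop} (h : DefinableRel L P) :
    ∃ (n : ℕ) (b : Fin n → G) (φ : L.Formula (Fin n ⊕ α)), ∀ v, φ.Realize (Sum.elim b v) ↔ P v := by
  obtain ⟨A, -, h⟩ := Set.definable_iff_finitely_definable.1 (definableRel_iff_definable.1 h)
  obtain ⟨φ, hφ⟩ := Set.definable_iff_exists_formula_sum.1 h
  refine ⟨A.card, fun i => A.equivFin.symm i, φ.relabel (Sum.map A.equivFin id), fun v => ?_⟩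
  rw [Formula.realize_relabel, Sum.elim_comp_map]
  refine Iff.trans (iff_of_eq (congrArg φ.Realize ?_)) (Set.ext_iff.1 hφ v).symm
  ext (a | i)
  · exact congrArg Subtype.val (A.equivFin.symm_apply_apply a)
  · rfl

theorem DefinableRel.of_formula (φ : L.Formula α) :
    DefinableRel L fun v : α → G => φ.Realize v :=
  Defines.definableRel (θ := φ.relabel Sum.inr) fun v => by
    rw [Formula.realize_relabel, Sum.elim_comp_inr]

theorem realize_elim_none_some {φ : L.Formula (Option α)} (w : Option α → G) :
    φ.Realize (Option.elim · (w none) fun i => w (some i)) ↔ φ.Realize w :=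
  iff_of_eq (congrArg φ.Realize (funext (Option.elim_none_some w)))

theorem DefinableFamily.exists_params {S : (α → G) → Set G} (hS : DefinableFamily L S) :
    ∃ (n : ℕ) (b : Fin n → G) (φ : L.Formula (Option (Fin n ⊕ α))),
      ∀ v, {y | φ.Realize (Option.elim · y (Sum.elim b v))} = S v := by
  obtain ⟨n, b, φ, hφ⟩ := DefinableRel.exists_params hS
  refine ⟨n, b, φ.relabel (Sum.elim (fun i => some (Sum.inl i)) (Option.map Sum.inr)),
    fun v => Set.ext fun y => ?_⟩
  rw [Set.mem_ofPred_eq, Formula.realize_relabel]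
  refine Iff.trans (iff_of_eq (congrArg φ.Realize ?_)) (hφ (Option.elim · y v))
  ext (_ | _ | _) <;> rfl

theorem Interprets.coDefinableFamily {L₁ : FirstOrder.Language} {C G' : Type*} [L₁.Structure G]
    [L.Structure G'] [L₁.Structure G'] {f : C → G} {f' : C → G'} (H : Interprets L L₁ f f')
    (φ : L.Formula (Option α)) :
    CoDefinableFamily L₁ f f' (fun v => {y | φ.Realize (Option.elim · y v)})
      (fun v => {y | φ.Realize (Option.elim · y v)}) :=
  (H.formula φ).congr (fun w => (realize_elim_none_some w).symm)
    (fun w => (realize_elim_none_some w).symm)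

theorem DefinableFamily.of_formula (φ : L.Formula (Option α)) :
    DefinableFamily L fun v : α → G => {y | φ.Realize (Option.elim · y v)} :=
  (DefinableRel.of_formula φ).congr (fun w => (realize_elim_none_some w).symm)
    (fun w => (realize_elim_none_some w).symm)

theorem DefinableMap.const (c : G) : DefinableMap L fun _ : α → G => c :=
  CoDefinableFun.const c

theorem Interprets.definableRel {L₁ : FirstOrder.Language} [L₁.Structure G]
    (H : Interprets L L₁ (id : G → G) id) {P : (α → G) → Prop} (h : DefinableRel L P) :
    DefinableRel L₁ P := by
  obtain ⟨θ, hθ, -⟩ := h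
  exact ((H.formula θ).reindex id).congr hθ hθ

end DefinableRel

/-! ### Definable addition and order -/

section AddCoDefinable

/-- The graphs of the additions of `G` and `G'` are defined by the same formula. -/
def AddCoDefinable (L₁ : FirstOrder.Language) {C G G' : Type*} [Add G] [Add G']
    [L₁.Structure G] [L₁.Structure G'] (f : C → G) (f' : C → G') : Prop :=
  CoDefinableFun L₁ f f' (fun v : Fin 2 → G => v 0 + v 1) (fun v : Fin 2 → G' => v 0 + v 1)

theorem IsReductOver.addCoDefinable {L : FirstOrder.Language} {G : Type*} [L.Structure G] [Add G]
    (h : IsReductOver (Set.univ : Set G) groupLang L) :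
    AddCoDefinable L (id : G → G) (id : G → G) := by
  have hgraph : (∅ : Set G).Definable groupLang {v : Fin 3 → G | v 2 = v 0 + v 1} := by
    refine Set.empty_definable_iff.2 ⟨Term.equal (Term.var 2)
      (Functions.apply₂ (L := groupLang) PlusFunc.add (Term.var 0) (Term.var 1)),
      Set.ext fun v => ?_⟩
    rw [Set.mem_ofPred_eq, Set.mem_ofPred_eq, Formula.realize_equal]
    exact Iff.rfl
  exact (definableRel_iff_definable.2 (h 3 _ hgraph)).relabel ![some 0, some 1, none]

theorem addCoDefinable_groupLang {C G G' : Type*} [Add G] [Add G'] (f : C → G) (f' : C → G') :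
    AddCoDefinable groupLang f f' :=
  ⟨Term.equal (Term.var (.inr none)) (Functions.apply₂ (L := groupLang) PlusFunc.add
    (Term.var (.inr (some 0))) (Term.var (.inr (some 1)))),
    fun _ => Formula.realize_equal, fun _ => Formula.realize_equal⟩

theorem addCoDefinable_ordGroupLang {C G G' : Type*} [Add G] [LT G] [Add G'] [LT G'] (f : C → G)
    (f' : C → G') : AddCoDefinable ordGroupLang f f' :=
  ⟨Term.equal (Term.var (.inr none)) (Functions.apply₂ (L := ordGroupLang) PlusFunc.add
    (Term.var (.inr (some 0))) (Term.var (.inr (some 1)))),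
    fun _ => Formula.realize_equal, fun _ => Formula.realize_equal⟩

variable {L₁ : FirstOrder.Language} {C G G' α : Type*} [AddCommGroup G] [AddCommGroup G']
  [L₁.Structure G] [L₁.Structure G'] {f : C → G} {f' : C → G'}
  {F E : (α → G) → G} {F' E' : (α → G') → G'}

theorem CoDefinableFun.add (hadd : AddCoDefinable L₁ f f') (hF : CoDefinableFun L₁ f f' F F')
    (hE : CoDefinableFun L₁ f f' E E') :
    CoDefinableFun L₁ f f' (fun v => F v + E v) (fun v => F' v + E' v) :=
  CoDefinableFun.comp hadd (F := ![F, E]) (F' := ![F', E']) (Fin.forall_fin_two.2 ⟨hF, hE⟩)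

theorem CoDefinableFun.neg (hadd : AddCoDefinable L₁ f f') (hF : CoDefinableFun L₁ f f' F F') :
    CoDefinableFun L₁ f f' (fun v => -F v) (fun v => -F' v) :=
  (CoDefinable.eq (((CoDefinableFun.proj none).add hadd (hF.relabel some)).add hadd
    (CoDefinableFun.proj none)) (CoDefinableFun.proj none)).congr
    (fun _ => add_eq_right.trans eq_neg_iff_add_eq_zero.symm)
    (fun _ => add_eq_right.trans eq_neg_iff_add_eq_zero.symm)

theorem CoDefinableFun.zero (hadd : AddCoDefinable L₁ f f') :
    CoDefinableFun L₁ f f' (fun _ : α → G => 0) (fun _ : α → G' => 0) :=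
  (CoDefinable.eq ((CoDefinableFun.proj none).add hadd (CoDefinableFun.proj none))
    (CoDefinableFun.proj none)).congr (fun _ => add_eq_right) (fun _ => add_eq_right)

theorem CoDefinableFun.nsmul (hadd : AddCoDefinable L₁ f f') (hF : CoDefinableFun L₁ f f' F F')
    (n : ℕ) : CoDefinableFun L₁ f f' (fun v => n • F v) (fun v => n • F' v) := by
  induction n with
  | zero => simpa only [zero_smul] using CoDefinableFun.zero hadd
  | succ n ih => simpa only [succ_nsmul] using ih.add hadd hF

theorem CoDefinableFun.sub (hadd : AddCoDefinable L₁ f f') (hF : CoDefinableFun L₁ f f' F F')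
    (hE : CoDefinableFun L₁ f f' E E') :
    CoDefinableFun L₁ f f' (fun v => F v - E v) (fun v => F' v - E' v) := by
  simpa only [sub_eq_add_neg] using hF.add hadd (hE.neg hadd)

theorem CoDefinableFamily.affine_preimage {β : Type*} [Finite β] {S : (β → G) → Set G}
    {S' : (β → G') → Set G'} (hS : CoDefinableFamily L₁ f f' S S')
    (hadd : AddCoDefinable L₁ f f') (n : ℕ) :
    CoDefinableFamily L₁ f f'
      (fun v : Option β → G => {y | v none + n • y ∈ S fun i => v (some i)})
      (fun v => {y | v none + n • y ∈ S' fun i => v (some i)}) :=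
  hS.mem_comp (fun i => some (some i)) <|
    (CoDefinableFun.proj (some none)).add hadd ((CoDefinableFun.proj none).nsmul hadd n)

variable [LinearOrder G] [LinearOrder G']

theorem CoDefinable.lt {f : C → G} {f' : C → G'} (hF : CoDefinableFun ordGroupLang f f' F F')
    (hE : CoDefinableFun ordGroupLang f f' E E') :
    CoDefinable ordGroupLang f f' (fun v => F v < E v) (fun v => F' v < E' v) := by
  have hlt : CoDefinable ordGroupLang f f' (fun v : Fin 2 → G => v 0 < v 1)
      (fun v => v 0 < v 1) :=
    ⟨Relations.formula (L := ordGroupLang) LessRel.lt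
      ![Term.var (Sum.inr 0), Term.var (Sum.inr 1)], fun _ => Iff.rfl, fun _ => Iff.rfl⟩
  exact hlt.comp (F := ![F, E]) (F' := ![F', E']) (Fin.forall_fin_two.2 ⟨hF, hE⟩)

theorem CoDefinable.le {f : C → G} {f' : C → G'} (hF : CoDefinableFun ordGroupLang f f' F F')
    (hE : CoDefinableFun ordGroupLang f f' E E') :
    CoDefinable ordGroupLang f f' (fun v => F v ≤ E v) (fun v => F' v ≤ E' v) :=
  (CoDefinable.lt hE hF).not.congr (fun _ => not_lt) (fun _ => not_lt)

end AddCoDefinable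

/-! ### Regular groups and small quotients -/

section Regular

/-- Approximate divisibility: each interval `[x, x + m • w]` with `0 < w` meets `mG`. For ordered
groups this is regularity in the sense of Robinson and Zakon, stated so as not to distinguish
discrete from dense groups. -/
def IsRegularGroup (G : Type*) [AddCommGroup G] [LinearOrder G] : Prop :=
  ∀ m : ℕ, 0 < m → ∀ x w : G, 0 < w → ∃ y, x ≤ m • y ∧ m • y ≤ x + m • w

/-- Some `k` elements (not necessarily pairwise incongruent) represent all the cosets of `nG`. -/
def HasCosetReps (G : Type*) [AddCommGroup G] (n k : ℕ) : Prop :=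
  ∃ r : Fin k → G, ∀ x, ∃ i y, x = r i + n • y

theorem isRegularGroup_of_archimedean (H : Type*) [AddCommGroup H] [LinearOrder H]
    [IsOrderedAddMonoid H] [Archimedean H] : IsRegularGroup H := by
  intro m hm x w hw
  obtain ⟨k, ⟨hxk, hkx⟩, -⟩ := existsUnique_add_zsmul_mem_Ico (nsmul_pos hw hm.ne') 0 x
  rw [zero_add, smul_comm] at hxk hkx
  exact ⟨k • w, hxk, hkx.le⟩

theorem hasSmallQuotients_iff_hasCosetReps {H : Type*} [AddCommGroup H] :
    HasSmallQuotients H ↔ ∀ n, 0 < n → ∃ k, HasCosetReps H n k := by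
  refine forall₂_congr fun n hn => ?_
  set K : AddSubgroup H := (nsmulAddMonoidHom n : H →+ H).range with hK
  have hcoset : ∀ a x : H, (a : H ⧸ K) = x ↔ ∃ y, x = a + n • y := fun a x => by
    rw [QuotientAddGroup.eq, hK, AddMonoidHom.mem_range]
    exact exists_congr fun y => by rw [nsmulAddMonoidHom_apply, eq_neg_add_iff_add_eq, eq_comm]
  constructor
  · intro _
    obtain ⟨k, ⟨e⟩⟩ := Finite.exists_equiv_fin (H ⧸ K)
    refine ⟨k, fun i => (e.symm i).out, fun x => ⟨e x, (hcoset _ _).1 ?_⟩⟩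
    rw [QuotientAddGroup.out_eq', e.symm_apply_apply]
  · rintro ⟨k, r, hr⟩
    have hsurj : Function.Surjective fun i => (r i : H ⧸ K) := by
      intro q
      induction q using QuotientAddGroup.induction_on with
      | H x => exact (hr x).imp fun i hi => (hcoset _ _).2 hi
    have := Finite.of_surjective _ hsurj
    exact AddSubgroup.finiteIndex_of_finite_quotient

variable {G G' : Type*} [AddCommGroup G] [LinearOrder G] [AddCommGroup G'] [LinearOrder G']

theorem IsRegularGroup.of_elementarilyEquivalent
    (e : G ≅[ordGroupLang] G') (h : IsRegularGroup G') : IsRegularGroup G := by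
  intro m hm
  have hadd := addCoDefinable_ordGroupLang (Empty.elim : Empty → G) (Empty.elim : Empty → G')
  refine (CoDefinable.iff_of_elementarilyEquivalent e (CoDefinable.forall (CoDefinable.forall
    ((CoDefinable.lt ?_ ?_).imp (CoDefinable.exists ((CoDefinable.le ?_ ?_).and
      (CoDefinable.le ?_ ?_))))))).2 (h m hm)
  · exact CoDefinableFun.zero hadd
  · exact CoDefinableFun.proj none
  · exact CoDefinableFun.proj (some (some none))
  · exact (CoDefinableFun.proj none).nsmul hadd m
  · exact (CoDefinableFun.proj none).nsmul hadd m
  · exact (CoDefinableFun.proj (some (some none))).add hadd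
      ((CoDefinableFun.proj (some none)).nsmul hadd m)

theorem HasSmallQuotients.of_elementarilyEquivalent (e : G ≅[ordGroupLang] G')
    (h : HasSmallQuotients G') : HasSmallQuotients G := by
  have hadd := addCoDefinable_ordGroupLang (Empty.elim : Empty → G) (Empty.elim : Empty → G')
  refine hasSmallQuotients_iff_hasCosetReps.2 fun n hn =>
    (hasSmallQuotients_iff_hasCosetReps.1 h n hn).imp fun k =>
      (CoDefinable.iff_of_elementarilyEquivalent e ?_).2
  exact CoDefinable.exists_tuple (CoDefinable.forall (CoDefinable.finite_exists fun i =>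
    CoDefinable.exists (CoDefinable.eq (CoDefinableFun.proj (some none))
      ((CoDefinableFun.proj (some (some (Sum.inr i)))).add hadd
        ((CoDefinableFun.proj none).nsmul hadd n)))))

end Regular

/-! ### The reduct of an elementary extension -/

section Reduct

variable {L L' : FirstOrder.Language} {G G' : Type*} [L.Structure G] [L'.Structure G]
  [L'.Structure G']

theorem CoDefinable.of_formula (f : G → G') {α : Type*} (θ : L'.Formula (G ⊕ α)) :
    CoDefinable L' id f (fun v => θ.Realize (Sum.elim id v)) fun v => θ.Realize (Sum.elim f v) :=
  ⟨θ, fun _ => Iff.rfl, fun _ => Iff.rfl⟩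

theorem CoDefinable.iff {α : Type*} {C : Type*} {f : C → G} {f' : C → G'} {P Q : (α → G) → Prop}
    {P' Q' : (α → G') → Prop} (hP : CoDefinable L' f f' P P') (hQ : CoDefinable L' f f' Q Q') :
    CoDefinable L' f f' (fun v => P v ↔ Q v) (fun v => P' v ↔ Q' v) :=
  ((hP.imp hQ).and (hQ.imp hP)).congr (fun _ => iff_iff_implies_and_implies.symm)
    (fun _ => iff_iff_implies_and_implies.symm)

theorem CoDefinable.forall_iff_of_elementaryEmbedding {f : G ↪ₑ[L'] G'} {α : Type*} [Finite α]
    {P : (α → G) → Prop} {P' : (α → G') → Prop} (h : CoDefinable L' id f P P') :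
    (∀ v, P v) ↔ ∀ v, P' v :=
  CoDefinable.iff_of_elementaryEmbedding (f := f) (CoDefinable.forall_tuple (α := Empty)
    (P := fun _ => P) (P' := fun _ => P') (h.relabel Sum.inr))

theorem realize_iff_realize_of_elementaryEmbedding (f : G ↪ₑ[L'] G') {α : Type*} [Finite α]
    {θ η : L'.Formula (G ⊕ α)} :
    (∀ v, θ.Realize (Sum.elim id v) ↔ η.Realize (Sum.elim id v)) ↔
      ∀ v, θ.Realize (Sum.elim f v) ↔ η.Realize (Sum.elim f v) :=
  ((CoDefinable.of_formula f θ).iff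
    (CoDefinable.of_formula f η)).forall_iff_of_elementaryEmbedding

theorem IsReductOver.exists_defines_funMap (h : IsReductOver (Set.univ : Set G) L L') {n : ℕ}
    (F : L.Functions n) : ∃ θ : L'.Formula (G ⊕ Fin (n + 1)), ∀ (v : Fin n → G) (w : G),
      θ.Realize (Sum.elim id (Fin.snoc v w : Fin (n + 1) → G)) ↔ Structure.funMap F v = w := by
  have hgraph : (∅ : Set G).Definable L
      {v : Fin (n + 1) → G | Structure.funMap F (fun i => v i.castSucc) = v (Fin.last n)} := by
    refine Set.empty_definable_iff.2 ⟨Term.equal (Term.func F fun i => Term.var i.castSucc)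
      (Term.var (Fin.last n)), Set.ext fun v => ?_⟩
    rw [Set.mem_ofPred_eq, Set.mem_ofPred_eq, Formula.realize_equal]
    exact Iff.rfl
  obtain ⟨θ, hθ, -⟩ := definableRel_iff_definable.2 (h (n + 1) _ hgraph)
  exact ⟨θ, fun v w => (hθ _).trans (by simp)⟩

theorem IsReductOver.exists_defines_relMap (h : IsReductOver (Set.univ : Set G) L L') {n : ℕ}
    (R : L.Relations n) : ∃ θ : L'.Formula (G ⊕ Fin n), Defines θ id (Structure.RelMap R) := by
  have hrel : (∅ : Set G).Definable L {v : Fin n → G | Structure.RelMap R v} := by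
    refine Set.empty_definable_iff.2 ⟨Relations.formula R fun i => Term.var i,
      Set.ext fun v => ?_⟩
    rw [Set.mem_ofPred_eq, Set.mem_ofPred_eq, Formula.realize_rel]
    exact Iff.rfl
  obtain ⟨θ, hθ, -⟩ := definableRel_iff_definable.2 (h n _ hrel)
  exact ⟨θ, hθ⟩

theorem CoDefinable.snoc {C : Type*} {f : C → G} {f' : C → G'} {n : ℕ}
    {P : (Fin (n + 1) → G) → Prop} {P' : (Fin (n + 1) → G') → Prop}
    (h : CoDefinable L' f f' P P') :
    CoDefinable L' f f'
      (fun w : Option (Fin n) → G => P (Fin.snoc (fun i => w (some i)) (w none)))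
      (fun w => P' (Fin.snoc (fun i => w (some i)) (w none))) := by
  refine (h.relabel (Fin.snoc (α := fun _ => Option (Fin n)) some none)).congr ?_ ?_ <;>
  · intro w
    rw [← Function.comp_def, Fin.comp_snoc]
    exact Iff.rfl

theorem IsReductOver.interprets_id (h : IsReductOver (Set.univ : Set G) L L') :
    Interprets L L' (id : G → G) (id : G → G) where
  funMap F := by
    obtain ⟨θ, hθ⟩ := h.exists_defines_funMap F
    exact (CoDefinable.of_formula id θ).snoc.congr (fun _ => (hθ _ _).trans eq_comm)
      (fun _ => (hθ _ _).trans eq_comm)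
  relMap R := by
    obtain ⟨θ, hθ⟩ := h.exists_defines_relMap R
    exact ⟨θ, hθ, hθ⟩

theorem existsUnique_realize_of_elementaryEmbedding (f : G ↪ₑ[L'] G') {n : ℕ}
    {θ : L'.Formula (G ⊕ Fin (n + 1))}
    (h : ∀ v : Fin n → G, ∃ y, ∀ z, θ.Realize (Sum.elim id (Fin.snoc v z : Fin (n + 1) → G)) ↔
      z = y) (v : Fin n → G') :
    ∃ y, ∀ z, θ.Realize (Sum.elim f (Fin.snoc v z : Fin (n + 1) → G')) ↔ z = y := by
  have hcodef : CoDefinable L' id f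
      (fun v : Fin n → G => ∃ y, ∀ z,
        θ.Realize (Sum.elim id (Fin.snoc v z : Fin (n + 1) → G)) ↔ z = y)
      (fun v => ∃ y, ∀ z, θ.Realize (Sum.elim f (Fin.snoc v z : Fin (n + 1) → G')) ↔ z = y) :=
    CoDefinable.exists (CoDefinable.forall
    (((CoDefinable.of_formula f θ).snoc.relabel (Option.map some)).iff
      (CoDefinable.eq (α := Option (Option (Fin n))) (CoDefinableFun.proj none)
        (CoDefinableFun.proj (some none)))))
  exact (CoDefinable.forall_iff_of_elementaryEmbedding hcodef).1 h v

theorem reductStructure_funMap_eq_iff [Nonempty G'] (f : G ↪ₑ[L'] G') {n : ℕ} {F : L.Functions n}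
    {θ : L'.Formula (G ⊕ Fin (n + 1))}
    (hθ : ∀ (v : Fin n → G) (w : G),
      θ.Realize (Sum.elim id (Fin.snoc v w : Fin (n + 1) → G)) ↔ Structure.funMap F v = w)
    (v : Fin n → G') (w : G') :
    (reductStructure L f).funMap F v = w ↔
      θ.Realize (Sum.elim f (Fin.snoc v w : Fin (n + 1) → G')) := by
  obtain ⟨y, hy⟩ := existsUnique_realize_of_elementaryEmbedding f
    (fun v => ⟨Structure.funMap F v, fun z => (hθ v z).trans eq_comm⟩) v
  let p : G' → Prop := fun z => ∃ η : L'.Formula (G ⊕ Fin (n + 1)),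
    (∀ (v : Fin n → G) (w : G), η.Realize (Sum.elim id (Fin.snoc v w : Fin (n + 1) → G)) ↔
      Structure.funMap F v = w) ∧
    η.Realize (Sum.elim f (Fin.snoc v z : Fin (n + 1) → G'))
  have hp : ∀ z, p z ↔ z = y := by
    refine fun z => ⟨fun ⟨η, hη, hz⟩ => (hy z).1 ?_, fun h => ⟨θ, hθ, (hy z).2 h⟩⟩
    refine (realize_iff_realize_of_elementaryEmbedding f).1 (fun v => ?_) _ |>.1 hz
    rw [← Fin.snoc_init_self v, hη, hθ]
  have hfunMap : (reductStructure L f).funMap F v = y :=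
    (hp _).1 (Classical.epsilon_spec (p := p) ⟨y, (hp y).2 rfl⟩)
  rw [hfunMap, hy, eq_comm]

theorem IsReductOver.interprets_reductStructure [Nonempty G']
    (h : IsReductOver (Set.univ : Set G) L L') (f : G ↪ₑ[L'] G') :
    letI := reductStructure L f
    Interprets L L' (id : G → G) f := by
  let _ := reductStructure L f
  refine ⟨fun F => ?_, fun R => ?_⟩
  · obtain ⟨θ, hθ⟩ := h.exists_defines_funMap F
    exact (CoDefinable.of_formula f θ).snoc.congr (fun _ => (hθ _ _).trans eq_comm)
      (fun _ => (reductStructure_funMap_eq_iff f hθ _ _).symm.trans eq_comm)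
  · obtain ⟨θ, hθ⟩ := h.exists_defines_relMap R
    refine ⟨θ, hθ, fun v => ⟨fun hv => ⟨θ, hθ, hv⟩, fun ⟨η, hη, hv⟩ => ?_⟩⟩
    exact (realize_iff_realize_of_elementaryEmbedding f).1
      (fun v => (hη v).trans (hθ v).symm) v |>.1 hv

theorem DefinableRel.exists_preimage_eq [L.Structure G'] {f : G ↪ₑ[L'] G'}
    (H : Interprets L L' (id : G → G) f) {D : Set G}
    (hD : DefinableRel L fun v : Unit → G => v () ∈ D) :
    ∃ D' : Set G', DefinableRel L (fun v : Unit → G' => v () ∈ D') ∧ f ⁻¹' D' = D := by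
  obtain ⟨θ, hθ, -⟩ := hD
  refine ⟨{x | θ.Realize (Sum.elim f fun _ => x)}, ?_, Set.ext fun y => ?_⟩
  · refine Defines.definableRel (θ := θ.relabel (Sum.map f id)) fun v => ?_
    rw [Formula.realize_relabel, Sum.elim_comp_map]
    exact Iff.rfl
  · have hf := (H.formula θ).comp_iff_of_elementaryEmbedding (Sum.elim id fun _ => y)
    rw [Sum.comp_elim] at hf
    exact hf.trans (hθ fun _ => y)

end Reduct

/-! ### Quantifier elimination -/

section Affine

variable {G α β : Type*} [AddCommGroup G]

/-- Functions of the form `∑ cᵢ vᵢ + a` with integers `cᵢ`. -/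
inductive IsAffine {G α : Type*} [AddCommGroup G] : ((α → G) → G) → Prop
  | proj (i : α) : IsAffine fun v => v i
  | const (c : G) : IsAffine fun _ => c
  | add {F E : (α → G) → G} : IsAffine F → IsAffine E → IsAffine fun v => F v + E v
  | neg {F : (α → G) → G} : IsAffine F → IsAffine fun v => -F v

/-- Congruence modulo `nG`. -/
def CongrMod {G : Type*} [AddCommGroup G] (n : ℕ) (a b : G) : Prop := ∃ g, b = a + n • g

theorem CongrMod.refl (n : ℕ) (a : G) : CongrMod n a a :=
  ⟨0, by rw [smul_zero, add_zero]⟩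

theorem CongrMod.neg {n : ℕ} {a b : G} (h : CongrMod n a b) : CongrMod n (-a) (-b) := by
  obtain ⟨g, rfl⟩ := h
  exact ⟨-g, by rw [smul_neg, neg_add]⟩

theorem CongrMod.symm {n : ℕ} {a b : G} (h : CongrMod n a b) : CongrMod n b a := by
  obtain ⟨g, rfl⟩ := h
  exact ⟨-g, by rw [smul_neg, add_neg_cancel_right]⟩

theorem CongrMod.add {n : ℕ} {a b c d : G} (h : CongrMod n a b) (h' : CongrMod n c d) :
    CongrMod n (a + c) (b + d) := by
  obtain ⟨g, rfl⟩ := h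
  obtain ⟨g', rfl⟩ := h'
  exact ⟨g + g', by rw [smul_add, add_add_add_comm]⟩

theorem CongrMod.of_dvd {m n : ℕ} (hmn : m ∣ n) {a b : G} (h : CongrMod n a b) :
    CongrMod m a b := by
  obtain ⟨k, rfl⟩ := hmn
  obtain ⟨g, rfl⟩ := h
  exact ⟨k • g, by rw [mul_smul]⟩

theorem IsAffine.sub {F E : (α → G) → G} (hF : IsAffine F) (hE : IsAffine E) :
    IsAffine fun v => F v - E v := by
  simpa only [sub_eq_add_neg] using hF.add hE.neg

theorem IsAffine.nsmul {F : (α → G) → G} (hF : IsAffine F) (n : ℕ) :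
    IsAffine fun v => n • F v := by
  induction n with
  | zero => simpa only [zero_smul] using IsAffine.const 0
  | succ n ih => simpa only [succ_nsmul] using ih.add hF

theorem IsAffine.zsmul {F : (α → G) → G} (hF : IsAffine F) (k : ℤ) :
    IsAffine fun v => k • F v := by
  obtain ⟨n, rfl | rfl⟩ := k.eq_nat_or_neg
  · simpa only [natCast_zsmul] using hF.nsmul n
  · simpa only [neg_zsmul, natCast_zsmul] using (hF.nsmul n).neg

theorem IsAffine.comp {F : (β → G) → G} (hF : IsAffine F) {E : β → (α → G) → G}
    (hE : ∀ i, IsAffine (E i)) : IsAffine fun v => F fun i => E i v := by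
  induction hF with
  | proj i => exact hE i
  | const c => exact IsAffine.const c
  | add _ _ h₁ h₂ => exact h₁.add h₂
  | neg _ h => exact h.neg

theorem IsAffine.congrMod {F : (α → G) → G} (hF : IsAffine F) {n : ℕ} {v w : α → G}
    (h : ∀ i, CongrMod n (v i) (w i)) : CongrMod n (F v) (F w) := by
  induction hF with
  | proj i => exact h i
  | const c => exact CongrMod.refl n c
  | add _ _ h₁ h₂ => exact h₁.add h₂
  | neg _ h => exact h.neg

theorem IsAffine.exists_eq_zsmul_add {F : (Option α → G) → G} (hF : IsAffine F) :
    ∃ (k : ℤ) (E : (α → G) → G), IsAffine E ∧ ∀ x v, F (Option.elim · x v) = k • x + E v := by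
  induction hF with
  | proj i =>
    rcases i with _ | i
    · exact ⟨1, _, IsAffine.const 0, fun x _ => by simp⟩
    · exact ⟨0, _, IsAffine.proj i, fun x v => by simp⟩
  | const c => exact ⟨0, _, IsAffine.const c, fun x _ => by simp⟩
  | add _ _ h₁ h₂ =>
    obtain ⟨k, E, hE, hF₁⟩ := h₁
    obtain ⟨l, D, hD, hF₂⟩ := h₂
    exact ⟨k + l, _, hE.add hD, fun x v => by
      beta_reduce; rw [hF₁, hF₂, add_smul, add_add_add_comm]⟩
  | neg _ h =>
    obtain ⟨k, E, hE, hF⟩ := h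
    exact ⟨-k, _, hE.neg, fun x v => by beta_reduce; rw [hF, neg_smul, neg_add]⟩

variable {ι : Type*} {σ : G → ι}

/-- Membership in `P` is determined by the values of `σ` at finitely many affine functions and by
the residues of the coordinates modulo some `n`. For the choices of `σ` below this says that `P` is
defined by a quantifier-free formula with congruences. -/
def DeterminedBy (σ : G → ι) (P : (α → G) → Prop) : Prop :=
  ∃ T : Set ((α → G) → G), T.Finite ∧ (∀ t ∈ T, IsAffine t) ∧ ∃ n : ℕ, 0 < n ∧
    ∀ v w, (∀ t ∈ T, σ (t v) = σ (t w)) → (∀ i, CongrMod n (v i) (w i)) → P v → P w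

theorem DeterminedBy.congr {P Q : (α → G) → Prop} (h : DeterminedBy σ P) (hPQ : ∀ v, P v ↔ Q v) :
    DeterminedBy σ Q :=
  (funext fun v => propext (hPQ v) : P = Q) ▸ h

theorem DeterminedBy.not {P : (α → G) → Prop} (h : DeterminedBy σ P) :
    DeterminedBy σ fun v => ¬ P v := by
  obtain ⟨T, hT, hA, n, hn, h⟩ := h
  exact ⟨T, hT, hA, n, hn, fun v w hσ hmod hP hw =>
    hP (h w v (fun t ht => (hσ t ht).symm) (fun i => (hmod i).symm) hw)⟩

theorem DeterminedBy.and {P Q : (α → G) → Prop} (hP : DeterminedBy σ P) (hQ : DeterminedBy σ Q) :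
    DeterminedBy σ fun v => P v ∧ Q v := by
  obtain ⟨T, hT, hA, n, hn, hP⟩ := hP
  obtain ⟨T', hT', hA', n', hn', hQ⟩ := hQ
  exact ⟨T ∪ T', hT.union hT', fun t ht => ht.elim (hA t) (hA' t), n * n', Nat.mul_pos hn hn',
    fun v w hσ hmod h =>
      ⟨hP v w (fun t ht => hσ t (Or.inl ht)) (fun i => (hmod i).of_dvd (Dvd.intro _ rfl)) h.1,
        hQ v w (fun t ht => hσ t (Or.inr ht)) (fun i => (hmod i).of_dvd (Dvd.intro_left _ rfl))
          h.2⟩⟩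

theorem DeterminedBy.comp {P : (β → G) → Prop} (h : DeterminedBy σ P) {E : β → (α → G) → G}
    (hE : ∀ i, IsAffine (E i)) : DeterminedBy σ fun v => P fun i => E i v := by
  obtain ⟨T, hT, hA, n, hn, h⟩ := h
  refine ⟨(fun t v => t fun i => E i v) '' T, hT.image _,
    Set.forall_mem_image.2 fun t ht => (hA t ht).comp hE, n, hn, fun v w hσ hmod hP => ?_⟩
  exact h _ _ (fun t ht => hσ _ ⟨t, ht, rfl⟩) (fun i => (hE i).congrMod hmod) hP

/-- The properties of `σ` which allow the elimination of an existential quantifier. In `step`, a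
point `x` in a position given by the values `σ (x + p.1)` is moved, within its residue class, to the
same position with respect to the parameters `p.2`; the finitely many differences whose values under
`σ` have to agree for this must not depend on `S`. -/
structure Eliminates (σ : G → ι) : Prop where
  eq_zero : ∀ {a b}, σ a = σ b → a = 0 → b = 0
  of_zsmul : ∀ {m : ℤ} {a b : G}, m ≠ 0 → σ (m • a) = σ (m • b) → σ a = σ b
  step : ∀ N : ℕ, 0 < N → ∃ D : Set G, D.Finite ∧ ∀ S : Set (G × G), S.Finite →
    (∀ p ∈ S, CongrMod N p.1 p.2) →
    (∀ p ∈ S, ∀ q ∈ S, ∀ d ∈ D, σ (p.1 - q.1 + d) = σ (p.2 - q.2 + d)) →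
    ∀ x, ∃ y, CongrMod N x y ∧ ∀ p ∈ S, σ (x + p.1) = σ (y + p.2)

theorem exists_pos_forall_dvd {X : Type*} {T : Set X} (hT : T.Finite) (k : X → ℤ) :
    ∃ c : ℕ, 0 < c ∧ ∀ t ∈ T, k t ≠ 0 → k t ∣ c := by
  classical
  refine ⟨∏ t ∈ hT.toFinset with k t ≠ 0, (k t).natAbs, Finset.prod_pos fun t ht => ?_,
    fun t ht hk => ?_⟩
  · exact Int.natAbs_pos.2 (Finset.mem_filter.1 ht).2
  · exact Int.natAbs_dvd.1 (Int.natCast_dvd_natCast.2 (Finset.dvd_prod_of_mem _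
      (Finset.mem_filter.2 ⟨hT.mem_toFinset.2 ht, hk⟩)))

/- Each affine function is `k • x + E v`. Multiplied by `m` with `m * k = c`, for a common multiple
`c` of the nonzero `k`, it becomes `c • x + m • E v`, so that `step` applies to `c • x`. -/
theorem DeterminedBy.exists (hσ : Eliminates σ) {P : (α → G) → G → Prop}
    (h : DeterminedBy σ fun w : Option α → G => P (fun i => w (some i)) (w none)) :
    DeterminedBy σ fun v => ∃ x, P v x := by
  obtain ⟨T, hT, hA, n, hn, h⟩ := h
  choose! k E hE hk using fun t ht => (hA t ht).exists_eq_zsmul_add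
  obtain ⟨c, hc, hdvd⟩ := exists_pos_forall_dvd hT k
  choose! m hm using hdvd
  have hm0 : ∀ t ∈ T, k t ≠ 0 → m t ≠ 0 := fun t ht ht0 h0 => hc.ne' <| by
    simpa only [h0, mul_zero, Nat.cast_eq_zero] using hm t ht ht0
  obtain ⟨D, hD, hstep⟩ := hσ.step (c * n) (Nat.mul_pos hc hn)
  refine ⟨E '' T ∪ (fun q : (((Option α → G) → G) × ((Option α → G) → G)) × G => fun v =>
      m q.1.1 • E q.1.1 v - m q.1.2 • E q.1.2 v + q.2) '' ((T ×ˢ T) ×ˢ D),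
    (hT.image _).union (((hT.prod hT).prod hD).image _), ?_, c * n, Nat.mul_pos hc hn, ?_⟩
  · rintro _ (⟨t, ht, rfl⟩ | ⟨q, ⟨⟨h₁, h₂⟩, -⟩, rfl⟩)
    · exact hE t ht
    · exact (((hE _ h₁).zsmul _).sub ((hE _ h₂).zsmul _)).add (IsAffine.const _)
  rintro v w hv hmod ⟨x, hx⟩
  obtain ⟨_, ⟨g, rfl⟩, hg⟩ := hstep ((fun t => (m t • E t v, m t • E t w)) '' {t ∈ T | k t ≠ 0})
    ((hT.subset fun t ht => ht.1).image _)
    (Set.forall_mem_image.2 fun t ht => ((hE t ht.1).zsmul _).congrMod hmod)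
    (Set.forall_mem_image.2 fun s hs => Set.forall_mem_image.2 fun t ht d hd =>
      hv _ (Or.inr ⟨((s, t), d), ⟨⟨hs.1, ht.1⟩, hd⟩, rfl⟩)) (c • x)
  refine ⟨x + n • g, h (Option.elim · x v) (Option.elim · (x + n • g) w) (fun t ht => ?_) ?_ hx⟩
  · rw [hk t ht, hk t ht]
    by_cases h0 : k t = 0
    · simpa only [h0, zero_smul, zero_add] using hv _ (Or.inl ⟨t, ht, rfl⟩)
    · have hscale : ∀ y z : G, m t • (k t • y + z) = c • y + m t • z := fun y z => by
        rw [smul_add, smul_smul, mul_comm, ← hm t ht h0, natCast_zsmul]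
      refine hσ.of_zsmul (hm0 t ht h0) ?_
      rw [hscale, hscale, smul_add, smul_smul]
      exact hg _ ⟨t, ⟨ht, h0⟩, rfl⟩
  · rintro (_ | i)
    · exact ⟨g, rfl⟩
    · exact (hmod i).of_dvd (Dvd.intro_left _ rfl)

variable {L : FirstOrder.Language} [L.Structure G]

theorem isAffine_realize (hF : ∀ {n} (F : L.Functions n), IsAffine fun v : Fin n → G =>
    Structure.funMap F v) (t : L.Term α) : IsAffine fun v : α → G => t.realize v := by
  induction t with
  | var i => exact IsAffine.proj i
  | func F ts ih => exact (hF F).comp ih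

theorem DeterminedBy.boundedFormula (hσ : Eliminates σ)
    (hF : ∀ {n} (F : L.Functions n), IsAffine fun v : Fin n → G => Structure.funMap F v)
    (hR : ∀ {n} (R : L.Relations n), DeterminedBy σ fun v : Fin n → G => Structure.RelMap R v)
    {n : ℕ} (φ : L.BoundedFormula α n) :
    DeterminedBy σ fun w : α ⊕ Fin n → G => φ.Realize (w ∘ Sum.inl) (w ∘ Sum.inr) := by
  induction φ with
  | falsum => exact ⟨∅, Set.finite_empty, by simp, 1, one_pos, fun _ _ _ _ h => h⟩
  | equal t₁ t₂ =>
    have hsub := (isAffine_realize hF t₁).sub (isAffine_realize hF t₂)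
    refine DeterminedBy.congr (P := fun w => t₁.realize w - t₂.realize w = 0)
      ⟨{fun w => t₁.realize w - t₂.realize w}, Set.finite_singleton _,
        fun t ht => Set.mem_singleton_iff.1 ht ▸ hsub, 1, one_pos,
        fun v w h _ => hσ.eq_zero (h _ rfl)⟩ fun w => sub_eq_zero.trans ?_
    change _ ↔ t₁.realize (Sum.elim (w ∘ Sum.inl) (w ∘ Sum.inr)) =
      t₂.realize (Sum.elim (w ∘ Sum.inl) (w ∘ Sum.inr))
    rw [Sum.elim_comp_inl_inr]
  | rel R ts =>
    refine ((hR R).comp fun i => isAffine_realize hF (ts i)).congr fun w => ?_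
    change _ ↔ Structure.RelMap R fun i =>
      (ts i).realize (Sum.elim (w ∘ Sum.inl) (w ∘ Sum.inr))
    rw [Sum.elim_comp_inl_inr]
  | imp φ ψ hφ hψ => exact (hφ.and hψ.not).not.congr fun w => not_and_not_right
  | @all n φ ih =>
    have hsnoc := ih.not.comp (α := Option (α ⊕ Fin n)) (E := fun i w => w (Sum.elim
      (some ∘ Sum.inl) (Fin.snoc (α := fun _ => Option (α ⊕ Fin n)) (some ∘ Sum.inr) none) i))
      fun i => IsAffine.proj _
    refine (DeterminedBy.exists hσ (P := fun w x =>
      ¬ φ.Realize (w ∘ Sum.inl) (Fin.snoc (w ∘ Sum.inr) x)) (hsnoc.congr fun w => ?_)).not.congr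
      fun w => not_exists_not
    rw [← Function.comp_def, Function.comp_assoc, Function.comp_assoc, Sum.elim_comp_inr,
      Fin.comp_snoc]
    exact Iff.rfl

theorem DefinableRel.determinedBy (hσ : Eliminates σ)
    (hF : ∀ {n} (F : L.Functions n), IsAffine fun v : Fin n → G => Structure.funMap F v)
    (hR : ∀ {n} (R : L.Relations n), DeterminedBy σ fun v : Fin n → G => Structure.RelMap R v)
    {P : (α → G) → Prop} (h : DefinableRel L P) : DeterminedBy σ P := by
  obtain ⟨θ, hθ, -⟩ := h
  have hformula := (DeterminedBy.boundedFormula hσ hF hR θ).comp (α := α)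
    (E := Sum.elim (Sum.elim (fun g _ => g) fun i v => v i) finZeroElim) <| by
      rintro ((g | i) | i)
      exacts [IsAffine.const g, IsAffine.proj i, i.elim0]
  refine hformula.congr fun v => Iff.trans ?_ (hθ v)
  rw [Formula.Realize]
  refine iff_of_eq (congr (congrArg _ (funext fun x => ?_)) (Subsingleton.elim _ _))
  rcases x with x | x <;> rfl

theorem DefinableRel.determinedBy_eq_zero (hσ : Eliminates fun x : G => x = 0)
    {P : (α → G) → Prop} (h : DefinableRel groupLang P) : DeterminedBy (fun x : G => x = 0) P := by
  refine DefinableRel.determinedBy hσ ?_ ?_ h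
  · rintro _ ⟨⟩
    exact (IsAffine.proj 0).add (IsAffine.proj 1)
  · intro _ R
    exact nomatch R

theorem exists_shift_of_add_eq_zero {N : ℕ} {S : Set (G × G)}
    (hσ : ∀ p ∈ S, ∀ q ∈ S, σ (p.1 - q.1) = σ (p.2 - q.2)) {p : G × G} (hp : p ∈ S)
    (hmod : CongrMod N p.1 p.2) {x : G} (hx : x + p.1 = 0) :
    ∃ y, CongrMod N x y ∧ ∀ q ∈ S, σ (x + q.1) = σ (y + q.2) := by
  obtain rfl := eq_neg_of_add_eq_zero_left hx
  refine ⟨-p.2, hmod.neg, fun q hq => ?_⟩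
  rw [neg_add_eq_sub, neg_add_eq_sub]
  exact hσ q hq p hp

theorem eliminates_eq_zero [IsAddTorsionFree G] [Infinite G] :
    Eliminates fun x : G => x = 0 where
  eq_zero h := (iff_of_eq h).1
  of_zsmul hm h := by simpa only [smul_eq_zero, hm, false_or] using h
  step N hN := by
    refine ⟨{0}, Set.finite_singleton _, fun S hS hmod hσ x => ?_⟩
    by_cases hp : ∃ p ∈ S, x + p.1 = 0
    · obtain ⟨p, hpS, hp⟩ := hp
      exact exists_shift_of_add_eq_zero (σ := (· = 0)) (fun p hp q hq => by
        simpa only [add_zero] using hσ p hp q hq 0 rfl) hpS (hmod p hpS) hp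
    · push Not at hp
      have hfin : (⋃ q ∈ S, {g : G | x + N • g + q.2 = 0}).Finite := by
        refine hS.biUnion fun q _ => Set.Subsingleton.finite fun a ha b hb => ?_
        have h : x + N • a + q.2 = x + N • b + q.2 := ha.trans hb.symm
        rwa [add_left_inj, add_right_inj, smul_right_inj hN.ne'] at h
      obtain ⟨g, hg⟩ := hfin.exists_notMem
      refine ⟨x + N • g, ⟨g, rfl⟩, fun q hq => ?_⟩
      rw [eq_iff_iff, iff_false_left (hp q hq)]
      exact fun h => hg (Set.mem_biUnion hq h)

end Affine

/-! ### Signs in regular groups -/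

section Sign

variable {G : Type*} [AddCommGroup G] [LinearOrder G]

theorem sign_eq_sign_iff {a b : G} :
    SignType.sign a = SignType.sign b ↔ (0 < a ↔ 0 < b) ∧ (a < 0 ↔ b < 0) := by
  rcases lt_trichotomy a 0 with ha | rfl | ha <;> rcases lt_trichotomy b 0 with hb | rfl | hb <;>
    simp [*, not_lt_of_gt]

variable [IsOrderedAddMonoid G]

theorem sign_nsmul {n : ℕ} (hn : n ≠ 0) (a : G) : SignType.sign (n • a) = SignType.sign a := by
  rw [sign_eq_sign_iff, nsmul_pos_iff hn, and_iff_right Iff.rfl, ← neg_pos, ← smul_neg,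
    nsmul_pos_iff hn, neg_pos]

theorem sign_eq_sign_of_zsmul {m : ℤ} {a b : G} (hm : m ≠ 0)
    (h : SignType.sign (m • a) = SignType.sign (m • b)) : SignType.sign a = SignType.sign b := by
  obtain ⟨n, rfl | rfl⟩ := m.eq_nat_or_neg
  · rwa [natCast_zsmul, natCast_zsmul, sign_nsmul (by simpa using hm),
      sign_nsmul (by simpa using hm)] at h
  · rwa [neg_zsmul, neg_zsmul, natCast_zsmul, natCast_zsmul, Left.sign_neg, Left.sign_neg, neg_inj,
      sign_nsmul (by simpa using hm), sign_nsmul (by simpa using hm)] at h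

theorem sign_add_eq_sign_add {a b d e : G} (ha : 0 < a) (hb : 0 < b) (had : d < 0 → a + d < 0)
    (hbe : e < 0 → b + e < 0) (hde : d < 0 ↔ e < 0) :
    SignType.sign (a + d) = SignType.sign (b + e) := by
  rcases lt_or_ge d 0 with hd | hd
  · rw [sign_neg (had hd), sign_neg (hbe (hde.1 hd))]
  · rw [sign_pos (add_pos_of_pos_of_nonneg ha hd),
      sign_pos (add_pos_of_pos_of_nonneg hb (not_lt.1 (hde.not.1 hd.not_gt)))]

theorem add_neg_of_le_abs_add {a d : G} (h : a ≤ |a + d|) (hd : d < 0) : a + d < 0 := by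
  by_contra hneg
  rw [abs_of_nonneg (not_lt.1 hneg)] at h
  exact hd.not_ge (nonneg_of_le_add_right h)

theorem exists_pos_forall_le_abs [Nontrivial G] {S : Set G} (hS : S.Finite) :
    ∃ η, 0 < η ∧ ∀ z ∈ S, z ≠ 0 → η ≤ |z| := by
  obtain ⟨a, ha⟩ := exists_zero_lt (α := G)
  obtain ⟨z, hz, hmin⟩ := Set.exists_min_image (insert a (S \ {0})) (|·|)
    (hS.sdiff.insert a) (Set.insert_nonempty _ _)
  refine ⟨|z|, abs_pos.2 ?_, fun y hy hy0 => hmin y (Or.inr ⟨hy, hy0⟩)⟩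
  rcases hz with rfl | hz
  exacts [ha.ne', hz.2]

theorem denselyOrdered_of_not_exists_isLeast (h : ¬ ∃ u : G, IsLeast (Set.Ioi 0) u) :
    DenselyOrdered G where
  dense x y hxy := by
    by_contra! hno
    refine h ⟨y - x, sub_pos.2 hxy, fun z hz => ?_⟩
    exact sub_le_iff_le_add'.2 (hno (x + z) (lt_add_of_pos_right x hz))

theorem exists_eq_nsmul_of_isLeast {u : G} (hu : IsLeast (Set.Ioi 0) u) {N : ℕ} {z : G}
    (h0 : 0 ≤ z) (hz : z ≤ N • u) : ∃ j ≤ N, z = j • u := by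
  induction N generalizing z with
  | zero => exact ⟨0, le_rfl, le_antisymm (hz.trans_eq (by simp)) (h0.trans_eq' (by simp))⟩
  | succ N ih =>
    rcases h0.eq_or_lt with rfl | h0
    · exact ⟨0, Nat.zero_le _, (zero_smul ℕ u).symm⟩
    · obtain ⟨j, hj, e⟩ := ih (sub_nonneg.2 (hu.2 h0))
        (sub_le_iff_le_add.2 (by rwa [← succ_nsmul]))
      exact ⟨j + 1, Nat.succ_le_succ hj, by rw [succ_nsmul, ← e, sub_add_cancel]⟩

theorem IsRegularGroup.exists_congrMod_nsmul (hr : IsRegularGroup G) {u : G}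
    (hu : IsLeast (Set.Ioi 0) u) {N : ℕ} (hN : 0 < N) {a : G} (ha : 0 < a) :
    ∃ j ≤ N, 0 < j • u ∧ j • u ≤ a ∧ CongrMod N a (j • u) := by
  rcases le_total a (N • u) with haN | haN
  · obtain ⟨j, hj, rfl⟩ := exists_eq_nsmul_of_isLeast hu ha.le haN
    exact ⟨j, hj, ha, le_rfl, CongrMod.refl _ _⟩
  obtain ⟨y, hy, hy'⟩ := hr N hN (-a) u hu.1
  obtain ⟨j, hj, hja⟩ := exists_eq_nsmul_of_isLeast hu (neg_le_iff_add_nonneg'.1 hy)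
    (le_neg_add_iff_add_le.1 hy')
  rcases Nat.eq_zero_or_pos j with rfl | hj0
  · refine ⟨N, le_rfl, nsmul_pos hu.1 hN.ne', haN, y + u, ?_⟩
    rw [smul_add, ← add_assoc, hja, zero_smul, zero_add]
  · exact ⟨j, hj, nsmul_pos hu.1 hj0.ne', (nsmul_le_nsmul_left hu.1.le hj).trans haN, y, hja.symm⟩

theorem IsRegularGroup.exists_congrMod_lt [DenselyOrdered G] (hr : IsRegularGroup G) {N : ℕ}
    (hN : 0 < N) (a : G) {η : G} (hη : 0 < η) : ∃ b, CongrMod N a b ∧ 0 < b ∧ b < η := by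
  obtain ⟨z, hz, hzη⟩ := exists_between hη
  obtain ⟨w, hw, hwη⟩ := exists_nsmul_lt_of_pos (sub_pos.2 hzη) N
  obtain ⟨y, hy, hy'⟩ := hr N hN (z - a) w hw
  refine ⟨a + N • y, ⟨y, rfl⟩, hz.trans_le (sub_le_iff_le_add'.1 hy), ?_⟩
  calc a + N • y ≤ a + (z - a + N • w) := add_le_add_right hy' a
    _ = z + N • w := by abel
    _ < η := add_lt_of_lt_sub_left hwη

section Shift

variable {N : ℕ} {S : Set (G × G)} {p : G × G} {x : G}

theorem IsRegularGroup.exists_shift_of_isLeast (hr : IsRegularGroup G) {u : G}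
    (hu : IsLeast (Set.Ioi 0) u) (hN : 0 < N) (hσ : ∀ p ∈ S, ∀ q ∈ S, ∀ j ≤ N,
      SignType.sign (p.1 - q.1 + j • u) = SignType.sign (p.2 - q.2 + j • u))
    (hp : p ∈ S) (hmod : CongrMod N p.1 p.2) (hpos : 0 < x + p.1)
    (hmin : ∀ q ∈ S, x + p.1 ≤ |x + q.1|) :
    ∃ y, CongrMod N x y ∧ ∀ q ∈ S, SignType.sign (x + q.1) = SignType.sign (y + q.2) := by
  obtain ⟨j, hj, hj0, hja, hmodj⟩ := hr.exists_congrMod_nsmul hu hN hpos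
  refine ⟨j • u - p.2, by simpa [sub_eq_add_neg] using hmodj.add hmod.neg, fun q hq => ?_⟩
  have hq₁ : x + q.1 = x + p.1 + (q.1 - p.1) := by abel
  have hq₂ : j • u - p.2 + q.2 = q.2 - p.2 + j • u := by abel
  rw [hq₂, ← hσ q hq p hp j hj, hq₁, add_comm _ (j • u)]
  have hneg : q.1 - p.1 < 0 → x + p.1 + (q.1 - p.1) < 0 :=
    add_neg_of_le_abs_add (hq₁ ▸ hmin q hq)
  exact sign_add_eq_sign_add hpos hj0 hneg (fun hd => (add_le_add_left hja _).trans_lt (hneg hd))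
    Iff.rfl

theorem IsRegularGroup.exists_shift_of_denselyOrdered [DenselyOrdered G] (hr : IsRegularGroup G)
    (hN : 0 < N) (hS : S.Finite)
    (hσ : ∀ p ∈ S, ∀ q ∈ S, SignType.sign (p.1 - q.1) = SignType.sign (p.2 - q.2))
    (hp : p ∈ S) (hmod : CongrMod N p.1 p.2) (hpos : 0 < x + p.1)
    (hmin : ∀ q ∈ S, x + p.1 ≤ |x + q.1|) :
    ∃ y, CongrMod N x y ∧ ∀ q ∈ S, SignType.sign (x + q.1) = SignType.sign (y + q.2) := by
  have : Nontrivial G := ⟨x + p.1, 0, hpos.ne'⟩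
  obtain ⟨η, hη, hηS⟩ := exists_pos_forall_le_abs (hS.image fun q => q.2 - p.2)
  obtain ⟨b, hmodb, hb, hbη⟩ := hr.exists_congrMod_lt hN (x + p.1) hη
  refine ⟨b - p.2, by simpa [sub_eq_add_neg] using hmodb.add hmod.neg, fun q hq => ?_⟩
  have hq₁ : x + q.1 = x + p.1 + (q.1 - p.1) := by abel
  rw [hq₁, sub_add_eq_add_sub, add_sub_assoc]
  refine sign_add_eq_sign_add hpos hb (add_neg_of_le_abs_add (hq₁ ▸ hmin q hq)) (fun hd => ?_)
    (sign_eq_sign_iff.1 (hσ q hq p hp)).2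
  have hηd := hηS _ ⟨q, hq, rfl⟩ hd.ne
  rw [abs_of_neg hd] at hηd
  exact lt_neg_iff_add_neg.1 (hbη.trans_le hηd)

theorem IsRegularGroup.exists_finite_shift (hr : IsRegularGroup G) (hN : 0 < N) :
    ∃ D : Set G, D.Finite ∧ (∀ d ∈ D, -d ∈ D) ∧ 0 ∈ D ∧ ∀ S : Set (G × G), S.Finite →
      (∀ p ∈ S, ∀ q ∈ S, ∀ d ∈ D,
        SignType.sign (p.1 - q.1 + d) = SignType.sign (p.2 - q.2 + d)) →
      ∀ p ∈ S, CongrMod N p.1 p.2 → ∀ x, 0 < x + p.1 → (∀ q ∈ S, x + p.1 ≤ |x + q.1|) →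
      ∃ y, CongrMod N x y ∧ ∀ q ∈ S, SignType.sign (x + q.1) = SignType.sign (y + q.2) := by
  by_cases h : ∃ u : G, IsLeast (Set.Ioi 0) u
  · obtain ⟨u, hu⟩ := h
    refine ⟨(fun j : ℤ => j • u) '' Set.Icc (-N) N, (Set.finite_Icc _ _).image _, ?_,
      ⟨0, by simp, zero_smul ℤ u⟩, fun S _ hσ p hp hmod x =>
        hr.exists_shift_of_isLeast hu hN (fun p hp q hq j hj => ?_) hp hmod⟩
    · rintro _ ⟨j, ⟨hj, hj'⟩, rfl⟩
      exact ⟨-j, ⟨neg_le_neg hj', neg_le.1 hj⟩, neg_smul j u⟩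
    · exact hσ p hp q hq _ ⟨j, ⟨by lia, by lia⟩, natCast_zsmul u j⟩
  · have := denselyOrdered_of_not_exists_isLeast h
    refine ⟨{0}, Set.finite_singleton _, by simp, rfl, fun S hS hσ p hp hmod x =>
      hr.exists_shift_of_denselyOrdered hN hS (fun p hp q hq => ?_) hp hmod⟩
    simpa only [add_zero] using hσ p hp q hq 0 rfl

end Shift

/- The point `x + p.1` closest to `0` is moved to a small point of the right residue and the same
sign; a negative one is reduced to a positive one by reflection. -/
theorem IsRegularGroup.eliminates_sign (hr : IsRegularGroup G) :
    Eliminates fun x : G => SignType.sign x where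
  eq_zero h ha := by
    rw [ha, sign_zero] at h
    exact sign_eq_zero_iff.1 h.symm
  of_zsmul := sign_eq_sign_of_zsmul
  step N hN := by
    obtain ⟨D, hD, hneg, h0, hshift⟩ := hr.exists_finite_shift hN
    refine ⟨D, hD, fun S hS hmod hσ x => ?_⟩
    rcases S.eq_empty_or_nonempty with rfl | hne
    · exact ⟨x, CongrMod.refl _ _, by simp⟩
    obtain ⟨p, hp, hmin⟩ := Set.exists_min_image S (fun q => |x + q.1|) hS hne
    rcases lt_trichotomy (x + p.1) 0 with hx | hx | hx
    · obtain ⟨y, hy, hyS⟩ := hshift (Neg.neg '' S) (hS.image _)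
        (Set.forall_mem_image.2 fun p hp => Set.forall_mem_image.2 fun q hq d hd => by
          rw [← neg_inj, ← Left.sign_neg, ← Left.sign_neg]
          convert hσ p hp q hq _ (hneg d hd) using 2 <;>
            simp only [Prod.fst_neg, Prod.snd_neg] <;> abel)
        (-p) ⟨p, hp, rfl⟩ (hmod p hp).neg (-x)
        (by rw [Prod.fst_neg, ← neg_add]; exact neg_pos.2 hx)
        (Set.forall_mem_image.2 fun q hq => by
          rw [Prod.fst_neg, Prod.fst_neg, ← neg_add, ← neg_add, abs_neg, ← abs_of_neg hx]
          exact hmin q hq)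
      refine ⟨-y, by simpa only [neg_neg] using hy.neg, fun q hq => ?_⟩
      rw [← neg_inj, ← Left.sign_neg, ← Left.sign_neg, neg_add, neg_add, neg_neg]
      exact hyS (-q) ⟨q, hq, rfl⟩
    · exact exists_shift_of_add_eq_zero (σ := fun x : G => SignType.sign x) (fun p hp q hq => by
        simpa only [add_zero] using hσ p hp q hq 0 h0) hp (hmod p hp) hx
    · exact hshift S hS hσ p hp (hmod p hp) x hx fun q hq => by
        rw [← abs_of_pos hx]
        exact hmin q hq

theorem IsRegularGroup.determinedBy_sign (hr : IsRegularGroup G) {α : Type*}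
    {P : (α → G) → Prop} (h : DefinableRel ordGroupLang P) :
    DeterminedBy (fun x : G => SignType.sign x) P := by
  refine DefinableRel.determinedBy hr.eliminates_sign ?_ ?_ h
  · rintro _ ⟨⟩
    exact (IsAffine.proj 0).add (IsAffine.proj 1)
  · rintro _ ⟨⟩
    refine ⟨{fun v => v 1 - v 0}, Set.finite_singleton _, fun t ht => ?_, 1, one_pos,
      fun v w hσ _ hv => ?_⟩
    · rw [Set.mem_singleton_iff.1 ht]
      exact (IsAffine.proj 1).sub (IsAffine.proj 0)
    · exact sub_pos.1 ((sign_eq_sign_iff.1 (hσ _ rfl)).1.1 (sub_pos.2 hv))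

end Sign

/-! ### Sets determined by the signs of affine functions -/

section InfiniteFibers

variable {X κ : Type*}

theorem exists_infinite_inter_fiber [Finite κ] (f : X → κ) {s : Set X} (hs : s.Infinite) :
    ∃ x ∈ s, (s ∩ f ⁻¹' {f x}).Infinite := by
  by_contra! h
  exact hs (Set.Finite.of_finite_fibers f (Set.toFinite _) (Set.forall_mem_image.2 h))

variable [LinearOrder X]

theorem exists_adjacent_infinite_fibers [Finite κ] [PartialOrder κ] {f : X → κ} (hf : Monotone f)
    {E : Set X} (hinf : E.Infinite) (hcoinf : Eᶜ.Infinite) :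
    ∃ x y, x < y ∧ (x ∈ E ↔ y ∉ E) ∧ (f ⁻¹' {f x}).Infinite ∧ (f ⁻¹' {f y}).Infinite ∧
      {z ∈ Set.Icc x y | f z ≠ f x ∧ f z ≠ f y}.Finite := by
  let P : X × X → Prop := fun q => q.1 < q.2 ∧ (q.1 ∈ E ↔ q.2 ∉ E) ∧
    (f ⁻¹' {f q.1}).Infinite ∧ (f ⁻¹' {f q.2}).Infinite
  have hP : ∃ q, P q := by
    obtain ⟨x, hx, hxi⟩ := exists_infinite_inter_fiber f hinf
    obtain ⟨y, hy, hyi⟩ := exists_infinite_inter_fiber f hcoinf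
    replace hxi := hxi.mono Set.inter_subset_right
    replace hyi := hyi.mono Set.inter_subset_right
    rcases lt_trichotomy x y with h | rfl | h
    · exact ⟨(x, y), h, iff_of_true hx hy, hxi, hyi⟩
    · exact absurd hx hy
    · exact ⟨(y, x), h, iff_of_false hy (not_not.2 hx), hyi, hxi⟩
  obtain ⟨⟨x, y⟩, ⟨hxy, hxyE, hx, hy⟩, hmin⟩ :=
    exists_minimalFor_of_wellFoundedLT P (fun q => (f '' Set.Icc q.1 q.2).ncard) hP
  refine ⟨x, y, hxy, hxyE, hx, hy, ?_⟩
  by_contra hbetween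
  obtain ⟨z, ⟨⟨hxz, hzy⟩, hzx, hzy'⟩, hz⟩ := exists_infinite_inter_fiber f hbetween
  replace hz := hz.mono Set.inter_subset_right
  have hcontra : ∀ q, P q → (f '' Set.Icc q.1 q.2) ⊂ f '' Set.Icc x y → False := fun q hq hlt =>
    (Set.ncard_lt_ncard hlt).not_ge (hmin hq (Set.ncard_le_ncard hlt.subset))
  by_cases hzE : x ∈ E ↔ z ∉ E
  · refine hcontra (x, z) ⟨hxz.lt_of_ne (ne_of_apply_ne f hzx.symm), hzE, hx, hz⟩
      ⟨Set.image_mono (Set.Icc_subset_Icc_right hzy), fun hsub => ?_⟩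
    obtain ⟨w, hw, hwy⟩ := hsub ⟨y, Set.right_mem_Icc.2 hxy.le, rfl⟩
    exact hzy' ((hf hzy).antisymm (hwy.symm.trans_le (hf hw.2)))
  · refine hcontra (z, y) ⟨hzy.lt_of_ne (ne_of_apply_ne f hzy'), by tauto, hz, hy⟩
      ⟨Set.image_mono (Set.Icc_subset_Icc_left hxz), fun hsub => ?_⟩
    obtain ⟨w, hw, hwx⟩ := hsub ⟨x, Set.left_mem_Icc.2 hxy.le, rfl⟩
    exact hzx (((hf hw.1).trans_eq hwx).antisymm (hf hxz))

theorem exists_infinite_ordConnected_disjoint {C F : Set X} (hC : C.OrdConnected)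
    (hinf : C.Infinite) (hF : F.Finite) :
    ∃ C' ⊆ C, C'.OrdConnected ∧ C'.Infinite ∧ Disjoint C' F := by
  induction F, hF using Set.Finite.induction_on with
  | empty => exact ⟨C, Set.Subset.rfl, hC, hinf, Set.disjoint_empty C⟩
  | @insert b F _ _ ih =>
    obtain ⟨C', hC'C, hC', hinf', hdisj⟩ := ih
    have hsplit : (C' ∩ Set.Iio b ∪ C' ∩ Set.Ioi b).Infinite := by
      rw [← Set.inter_union_distrib_left, Set.Iio_union_Ioi]
      exact hinf'.sdiff (Set.finite_singleton b)
    rcases Set.infinite_union.1 hsplit with h | h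
    · exact ⟨_, Set.inter_subset_left.trans hC'C, hC'.inter Set.ordConnected_Iio, h,
        Set.disjoint_insert_right.2 ⟨fun hb => lt_irrefl b hb.2,
          hdisj.mono_left Set.inter_subset_left⟩⟩
    · exact ⟨_, Set.inter_subset_left.trans hC'C, hC'.inter Set.ordConnected_Ioi, h,
        Set.disjoint_insert_right.2 ⟨fun hb => lt_irrefl b hb.2,
          hdisj.mono_left Set.inter_subset_left⟩⟩

end InfiniteFibers

theorem mem_of_ncard_le {X : Type*} {A B : Set X} (hB : B.Finite) {q : ℕ → X}
    (hq : Function.Injective q) {n : ℕ} (hn : B.ncard ≤ n) (hAB : ∀ i ≤ n, q i ∈ A ∨ q i ∈ B)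
    (hA : ∀ i ≤ n, q i ∈ A → q n ∈ A) : q n ∈ A := by
  by_contra hnA
  have hsub : q '' Set.Iic n ⊆ B := Set.image_subset_iff.2 fun i hi =>
    (hAB i hi).resolve_left fun hiA => hnA (hA i hi hiA)
  have hcard := Set.ncard_le_ncard hsub hB
  rw [Set.ncard_image_of_injective _ hq, Set.ncard_eq_toFinset_card', Set.toFinset_Iic,
    Nat.card_Iic] at hcard
  lia

theorem exists_progression_of_runs {G : Type*} [AddCommGroup G] {C D : Set G} {g w : G}
    (β N : ℕ)
    (h : ∀ n, β ≤ n → n ≤ N * (2 * β + 3) + β → g + (n + 2) • w ∈ D ∧ g - (n + 1) • w ∈ C) :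
    ∃ p w' : G, ∀ i : ℤ, |i| ≤ N → (0 < i → p + i • w' ∈ D) ∧ (i ≤ 0 → p + i • w' ∈ C) := by
  have hle : ∀ j : ℕ, |(j : ℤ)| ≤ N → j * (2 * β + 3) + β ≤ N * (2 * β + 3) + β := fun j hj => by
    gcongr
    simpa using hj
  refine ⟨g - (β + 1) • w, (2 * β + 3) • w, fun i hi => ⟨fun hi0 => ?_, fun hi0 => ?_⟩⟩
  · obtain ⟨j, rfl⟩ := Int.eq_succ_of_zero_lt hi0
    have hj := (hle (j + 1) (by simpa using hi)).trans' (by gcongr; lia : j * (2 * β + 3) + β ≤ _)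
    convert (h (j * (2 * β + 3) + β) (Nat.le_add_left _ _) hj).1 using 1
    module
  · obtain ⟨j, rfl⟩ := Int.exists_eq_neg_ofNat hi0
    convert (h (j * (2 * β + 3) + β) (Nat.le_add_left _ _) (hle j (by simpa using hi))).2 using 1
    module

section Convex

variable {G : Type*} [AddCommGroup G] [LinearOrder G] [IsOrderedAddMonoid G] {C D B : Set G}

theorem exists_add_nsmul_le_of_infinite (hC : C.Infinite) (n : ℕ) :
    ∃ w, 0 < w ∧ ∃ x ∈ C, ∃ y ∈ C, x + n • w ≤ y := by
  obtain ⟨s, hsC, hcard⟩ := hC.exists_subset_card_eq (n + 1)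
  obtain ⟨x, -, y, -, hxy⟩ := hC.nontrivial
  have : Nontrivial G := ⟨x, y, hxy⟩
  let a := s.orderEmbOfFin hcard
  obtain ⟨w, hw, hgap⟩ := exists_pos_forall_le_abs
    (Set.finite_range fun p : Fin (n + 1) × Fin (n + 1) => a p.1 - a p.2)
  have ha : ∀ i : Fin (n + 1), a 0 + (i : ℕ) • w ≤ a i := fun i => by
    induction i using Fin.induction with
    | zero => simp
    | succ i ih =>
      have hpos : 0 < a i.succ - a i.castSucc := sub_pos.2 (a.strictMono Fin.castSucc_lt_succ)
      have hstep : w ≤ a i.succ - a i.castSucc :=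
        (hgap _ ⟨(i.succ, i.castSucc), rfl⟩ hpos.ne').trans_eq (abs_of_pos hpos)
      rw [Fin.val_succ, succ_nsmul, ← add_assoc]
      exact (add_le_add_left ih w).trans (le_sub_iff_add_le'.1 hstep)
  exact ⟨w, hw, a 0, hsC (s.orderEmbOfFin_mem hcard 0), a (Fin.last n),
    hsC (s.orderEmbOfFin_mem hcard _), ha (Fin.last n)⟩

theorem IsRegularGroup.exists_nsmul_mem (hr : IsRegularGroup G) (hC : C.OrdConnected)
    (hinf : C.Infinite) {m : ℕ} (hm : 0 < m) : ∃ y, m • y ∈ C := by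
  obtain ⟨w, hw, x, hx, z, hz, hxz⟩ := exists_add_nsmul_le_of_infinite hinf m
  obtain ⟨y, hxy, hyx⟩ := hr m hm x w hw
  exact ⟨y, hC.out hx hz ⟨hxy, hyx.trans hxz⟩⟩

theorem IsRegularGroup.infinite_setOf_nsmul_mem (hr : IsRegularGroup G) (hC : C.OrdConnected)
    (hinf : C.Infinite) {m : ℕ} (hm : 0 < m) : {y | m • y ∈ C}.Infinite := by
  intro hfin
  obtain ⟨C', hC'C, hC', hinf', hdisj⟩ :=
    exists_infinite_ordConnected_disjoint hC hinf (hfin.image (m • ·))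
  obtain ⟨y, hy⟩ := hr.exists_nsmul_mem hC' hinf' hm
  exact Set.disjoint_left.1 hdisj hy ⟨y, hC'C hy, rfl⟩

theorem IsRegularGroup.exists_sign_change (hr : IsRegularGroup G) {k : ℕ} (hk : 0 < k) (e : G)
    {w : G} (hw : 0 < w) :
    ∃ g, (∀ i : ℕ, 0 < k • (g + (i + 2) • w) + e) ∧ (∀ i : ℕ, k • (g - (i + 1) • w) + e < 0) ∧
      0 ≤ k • (g + w) + e ∧ k • g + e ≤ 0 := by
  obtain ⟨g, hg, hg'⟩ := hr k hk (-e - k • w) w hw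
  have hpos : ∀ i : ℕ, 0 < k • ((i + 1) • w) := fun i =>
    nsmul_pos (nsmul_pos hw i.succ_ne_zero) hk.ne'
  refine ⟨g, fun i => ?_, fun i => ?_, ?_, ?_⟩
  · have := hpos i
    rw [← one_add_one_eq_two, ← add_assoc, succ_nsmul, smul_add, smul_add]
    grind
  · have := hpos i
    rw [smul_sub]
    grind
  · rw [smul_add]
    grind
  · grind

theorem IsRegularGroup.exists_runs (hr : IsRegularGroup G) (hC : C.OrdConnected)
    (hD : D.OrdConnected) (hCinf : C.Infinite) (hDinf : D.Infinite) (hB : B.Finite) {k : ℕ}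
    (hk : 0 < k) {e : G} (hneg : ∀ z ∈ C, k • z + e < 0) (hpos : ∀ z ∈ D, 0 < k • z + e)
    (hbetween : ∀ x ∈ C, ∀ y ∈ D, Set.Icc x y ⊆ C ∪ D ∪ B) (N : ℕ) :
    ∃ g w : G, ∀ n, B.ncard ≤ n → n ≤ N → g + (n + 2) • w ∈ D ∧ g - (n + 1) • w ∈ C := by
  obtain ⟨w₁, hw₁, x, hx, x', hx', hxx'⟩ := exists_add_nsmul_le_of_infinite hCinf (N + 2)
  obtain ⟨w₂, hw₂, y, hy, y', hy', hyy'⟩ := exists_add_nsmul_le_of_infinite hDinf (N + 2)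
  obtain ⟨w, hw, hww₁, hww₂⟩ : ∃ w, 0 < w ∧ w ≤ w₁ ∧ w ≤ w₂ :=
    ⟨min w₁ w₂, lt_min hw₁ hw₂, min_le_left _ _, min_le_right _ _⟩
  replace hxx' := (add_le_add_right (nsmul_le_nsmul_right hww₁ (N + 2)) x).trans hxx'
  replace hyy' := (add_le_add_right (nsmul_le_nsmul_right hww₂ (N + 2)) y).trans hyy'
  obtain ⟨g, hgpos, hgneg, hg₁, hg₀⟩ := hr.exists_sign_change hk e hw
  have hlt : ∀ {a b : G}, k • a + e < k • b + e → a < b := fun h =>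
    lt_of_nsmul_lt_nsmul_right k (lt_of_add_lt_add_right h)
  have hinj : Function.Injective fun i : ℕ => i • w := (nsmul_left_strictMono hw).injective
  have hx'g : x' < g + w := hlt ((hneg x' hx').trans_le hg₁)
  have hgy : g < y := hlt (hg₀.trans_lt (hpos y hy))
  have hle : ∀ {i j : ℕ}, i ≤ j → 0 ≤ i • w ∧ i • w ≤ j • w := fun h =>
    ⟨nsmul_nonneg hw.le _, nsmul_le_nsmul_left hw.le h⟩
  have hup : ∀ i ≤ N, x' ≤ g + (i + 2) • w ∧ g + (i + 2) • w ≤ y' := fun i hi => by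
    have := hle hi
    simp only [add_smul] at hyy' ⊢
    grind
  have hdown : ∀ i ≤ N, x ≤ g - (i + 1) • w ∧ g - (i + 1) • w ≤ y := fun i hi => by
    have := hle hi
    simp only [add_smul] at hxx' ⊢
    grind
  refine ⟨g, w, fun n hBn hnN => ⟨?_, ?_⟩⟩
  · refine mem_of_ncard_le hB (q := fun i => g + (i + 2) • w)
      ((add_right_injective g).comp (hinj.comp (add_left_injective 2))) hBn (fun i hi => ?_)
      fun i hi hiD => hD.out hiD hy' ⟨add_le_add_right (hle (by lia)).2 g, (hup n hnN).2⟩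
    have := hbetween x' hx' y' hy' (hup i (hi.trans hnN))
    exact (or_assoc.1 this).resolve_left fun hiC => (hgpos i).not_gt (hneg _ hiC)
  · refine mem_of_ncard_le hB (q := fun i => g - (i + 1) • w)
      (sub_right_injective.comp (hinj.comp (add_left_injective 1))) hBn (fun i hi => ?_)
      fun i hi hiC => hC.out hx hiC ⟨(hdown n hnN).1, sub_le_sub_left (hle (by lia)).2 g⟩
    have := hbetween x hx y hy (hdown i (hi.trans hnN))
    exact (or_right_comm.1 this).resolve_right fun hiD => (hgneg i).not_gt (hpos _ hiD)

end Convex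

section SignDet

variable {G : Type*} [AddCommGroup G] [LinearOrder G] {r : ℕ} {E : Set G}

/-- The signs at `y` of the `r` affine functions `k • z + e` with `(k, e)` in the list `t`. The
coefficients are natural numbers, so that the signs are monotone in `y`. -/
def signs (t : Fin r → ℕ × G) (y : G) (i : Fin r) : SignType :=
  SignType.sign ((t i).1 • y + (t i).2)

/-- Membership in `E` is determined by the signs of `r` affine functions. -/
def IsSignDetermined (r : ℕ) (E : Set G) : Prop :=
  ∃ t : Fin r → ℕ × G, ∀ y y', signs t y = signs t y' → y ∈ E → y' ∈ E

theorem IsSignDetermined.compl (h : IsSignDetermined r E) : IsSignDetermined r Eᶜ := by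
  obtain ⟨t, h⟩ := h
  exact ⟨t, fun y y' hs hy hy' => hy (h y' y hs.symm hy')⟩

variable [IsOrderedAddMonoid G]

theorem monotone_signs (t : Fin r → ℕ × G) : Monotone (signs t) := fun _ _ hxy i =>
  SignType.sign.monotone (add_le_add_left (nsmul_le_nsmul_right hxy (t i).1) (t i).2)

theorem exists_nat_sign_eq_sign (k : ℤ) (e : G) :
    ∃ (n : ℕ) (e' : G), ∀ y y', SignType.sign (n • y + e') = SignType.sign (n • y' + e') →
      SignType.sign (k • y + e) = SignType.sign (k • y' + e) := by
  obtain ⟨n, rfl | rfl⟩ := k.eq_nat_or_neg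
  · exact ⟨n, e, fun y y' h => by simpa only [natCast_zsmul] using h⟩
  · refine ⟨n, -e, fun y y' h => ?_⟩
    rw [← neg_inj, ← Left.sign_neg, ← Left.sign_neg]
    simpa only [neg_add, neg_zsmul, neg_neg, natCast_zsmul] using h

theorem DeterminedBy.exists_isSignDetermined {β : Type*} {S : (β → G) → Set G}
    (h : DeterminedBy (fun x : G => SignType.sign x)
      fun w : Option β → G => w none ∈ S fun i => w (some i)) :
    ∃ n : ℕ, 0 < n ∧ ∃ r, ∀ (b : β → G) (c : G), IsSignDetermined r {y | c + n • y ∈ S b} := by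
  obtain ⟨T, hT, hA, n, hn, h⟩ := h
  obtain ⟨r, f, -, rfl⟩ := hT.fin_param
  choose k E _ hk using fun i => (hA (f i) ⟨i, rfl⟩).exists_eq_zsmul_add
  refine ⟨n, hn, r, fun b c => ?_⟩
  choose l e hle using fun i => exists_nat_sign_eq_sign (k i * n) (k i • c + E i b)
  refine ⟨fun i => (l i, e i), fun y y' hs =>
    h (Option.elim · (c + n • y) b) (Option.elim · (c + n • y') b) ?_ ?_⟩
  · rintro _ ⟨i, rfl⟩
    have haffine : ∀ y : G,
        k i • (c + n • y) + E i b = (k i * n) • y + (k i • c + E i b) := fun y => by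
      rw [smul_add, mul_smul, natCast_zsmul, add_comm (k i • c), add_assoc]
    simpa only [hk, haffine] using hle i y y' (congrFun hs i)
  · rintro (_ | i)
    · exact ⟨y' - y, by simp only [Option.elim_none]; rw [add_assoc, ← smul_add, add_sub_cancel]⟩
    · exact CongrMod.refl n _

theorem exists_nsmul_add_neg_pos {t : Fin r → ℕ × G} {x y : G} (hxy : x < y)
    (hne : signs t x ≠ signs t y) (hx : (signs t ⁻¹' {signs t x}).Infinite)
    (hy : (signs t ⁻¹' {signs t y}).Infinite) :
    ∃ (k : ℕ) (e : G), 0 < k ∧ (∀ z ∈ signs t ⁻¹' {signs t x}, k • z + e < 0) ∧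
      ∀ z ∈ signs t ⁻¹' {signs t y}, 0 < k • z + e := by
  obtain ⟨-, i, hi⟩ := Pi.lt_def.1 ((monotone_signs t hxy.le).lt_of_ne hne)
  have hk : (t i).1 ≠ 0 := fun hk => hi.ne (by simp only [signs, hk, zero_smul])
  have hne_zero : ∀ {z}, (signs t ⁻¹' {signs t z}).Infinite → signs t z i ≠ 0 := by
    intro z hz hzi
    obtain ⟨a, ha, b, hb, hab⟩ := hz.nontrivial
    have hzero : ∀ c ∈ signs t ⁻¹' {signs t z}, (t i).1 • c + (t i).2 = 0 := fun c hc =>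
      sign_eq_zero_iff.1 ((congrFun hc i).trans hzi)
    exact hab (nsmul_right_injective hk
      (add_left_injective _ ((hzero a ha).trans (hzero b hb).symm)))
  have hsign : ∀ a b : SignType, a < b → a ≠ 0 → b ≠ 0 → a = -1 ∧ b = 1 := by decide
  obtain ⟨hxi, hyi⟩ := hsign _ _ hi (hne_zero hx) (hne_zero hy)
  exact ⟨(t i).1, (t i).2, hk.bot_lt, fun z hz => sign_eq_neg_one_iff.1 ((congrFun hz i).trans hxi),
    fun z hz => sign_eq_one_iff.1 ((congrFun hz i).trans hyi)⟩

theorem IsSignDetermined.infinite_setOf_nsmul_mem (hr : IsRegularGroup G)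
    (h : IsSignDetermined r E) (hE : E.Infinite) {m : ℕ} (hm : 0 < m) :
    {y | m • y ∈ E}.Infinite := by
  obtain ⟨t, h⟩ := h
  obtain ⟨x, hx, hinf⟩ := exists_infinite_inter_fiber (signs t) hE
  refine (hr.infinite_setOf_nsmul_mem
    (Set.ordConnected_singleton.preimage_mono (monotone_signs t))
    (hinf.mono Set.inter_subset_right) hm).mono fun y hy => h x _ (Eq.symm hy) hx

theorem IsRegularGroup.exists_progression_of_signs (hr : IsRegularGroup G) {t : Fin r → ℕ × G}
    (h : ∀ y y', signs t y = signs t y' → (y ∈ E ↔ y' ∈ E)) {x y : G} (hxy : x < y) (hxE : x ∉ E)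
    (hyE : y ∈ E) (hx : (signs t ⁻¹' {signs t x}).Infinite)
    (hy : (signs t ⁻¹' {signs t y}).Infinite)
    (hB : {z ∈ Set.Icc x y | signs t z ≠ signs t x ∧ signs t z ≠ signs t y}.Finite) (N : ℕ) :
    ∃ p w : G, ∀ i : ℤ, |i| ≤ N → (p + i • w ∈ E ↔ 0 < i) := by
  have hmono := monotone_signs t
  obtain ⟨k, e, hk, hneg, hpos⟩ :=
    exists_nsmul_add_neg_pos hxy (fun hs => hxE ((h x y hs).2 hyE)) hx hy
  set B := {z ∈ Set.Icc x y | signs t z ≠ signs t x ∧ signs t z ≠ signs t y}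
  have hbetween : ∀ x' ∈ signs t ⁻¹' {signs t x}, ∀ y' ∈ signs t ⁻¹' {signs t y},
      Set.Icc x' y' ⊆ signs t ⁻¹' {signs t x} ∪ signs t ⁻¹' {signs t y} ∪ B := by
    rintro x' hx' y' hy' z ⟨hxz, hzy⟩
    by_contra! hz
    obtain ⟨⟨hzx, hzy'⟩, hzB⟩ : (signs t z ≠ signs t x ∧ signs t z ≠ signs t y) ∧ z ∉ B := by
      simpa only [Set.mem_union, not_or, Set.mem_preimage, Set.mem_singleton_iff] using hz
    refine hzB ⟨⟨?_, ?_⟩, hzx, hzy'⟩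
    · exact le_of_not_ge fun hle => hzx ((hmono hle).antisymm (hx'.symm.trans_le (hmono hxz)))
    · exact le_of_not_ge fun hle => hzy' ((hmono hzy).trans_eq hy' |>.antisymm (hmono hle))
  obtain ⟨g, w, hgw⟩ := hr.exists_runs (Set.ordConnected_singleton.preimage_mono hmono)
    (Set.ordConnected_singleton.preimage_mono hmono) hx hy hB hk hneg hpos hbetween
    (N * (2 * B.ncard + 3) + B.ncard)
  obtain ⟨p, w', hpw⟩ := exists_progression_of_runs _ _ hgw
  refine ⟨p, w', fun i hi => ⟨fun hE => ?_, fun hi0 => (h _ y ((hpw i hi).1 hi0)).2 hyE⟩⟩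
  exact lt_of_not_ge fun hi0 => hxE ((h _ x ((hpw i hi).2 hi0)).1 hE)

theorem IsSignDetermined.exists_progression (hr : IsRegularGroup G) (h : IsSignDetermined r E)
    (hinf : E.Infinite) (hcoinf : Eᶜ.Infinite) (N : ℕ) :
    ∃ p w : G, ∀ i : ℤ, |i| ≤ N → (p + i • w ∈ E ↔ 0 < i) := by
  obtain ⟨t, h⟩ := h
  have hiff : ∀ y y', signs t y = signs t y' → (y ∈ E ↔ y' ∈ E) := fun y y' hs =>
    ⟨h y y' hs, h y' y hs.symm⟩
  obtain ⟨x, y, hxy, hxyE, hx, hy, hB⟩ :=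
    exists_adjacent_infinite_fibers (monotone_signs t) hinf hcoinf
  by_cases hxE : x ∈ E
  · obtain ⟨p, w, hpw⟩ := hr.exists_progression_of_signs (E := Eᶜ)
      (fun y y' hs => (hiff y y' hs).not) hxy (not_not.2 hxE) (hxyE.1 hxE) hx hy hB (N + 1)
    refine ⟨p + w, -w, fun i hi => ?_⟩
    have hflip := hpw (1 - i) ((abs_sub 1 i).trans (by rw [abs_one]; push_cast; lia))
    rw [Set.mem_compl_iff, not_iff_comm, not_lt, sub_smul, one_smul] at hflip
    rw [smul_neg, add_assoc, ← sub_eq_add_neg, ← hflip]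
    lia
  · exact hr.exists_progression_of_signs hiff hxy hxE (not_not.1 fun hyE => hxE (hxyE.2 hyE))
      hx hy hB N

end SignDet

/-! ### Stability -/

section Ladder

theorem exists_pairwise_sublist {X : Type*} (c : X → X → Prop) (m n : ℕ) {l : List X}
    (hl : (m + n).choose m ≤ l.length) :
    (∃ t : List X, t.Sublist l ∧ t.length = m ∧ t.Pairwise c) ∨
      ∃ t : List X, t.Sublist l ∧ t.length = n ∧ t.Pairwise fun x y => ¬ c x y := by
  classical
  induction m generalizing n l with
  | zero => exact Or.inl ⟨[], List.nil_sublist _, rfl, List.Pairwise.nil⟩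
  | succ m ihm =>
    induction n generalizing l with
    | zero => exact Or.inr ⟨[], List.nil_sublist _, rfl, List.Pairwise.nil⟩
    | succ n ihn =>
      cases l with
      | nil => exact absurd hl (Nat.choose_pos (Nat.le_add_right _ _)).not_ge
      | cons x l =>
        have hsplit := List.length_eq_length_filter_add (l := l) fun y => decide (c x y)
        have hchoose : (m + 1 + (n + 1)).choose (m + 1) =
            (m + (n + 1)).choose m + (m + 1 + n).choose (m + 1) := by
          rw [← add_assoc, Nat.choose_succ_succ', add_right_comm, add_assoc m]
        rw [hchoose, List.length_cons] at hl
        have hcons : ∀ {t : List X} {p : X → Bool} {R : X → X → Prop}, t.Sublist (l.filter p) →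
            (∀ y, p y → R x y) → t.Pairwise R → (x :: t).Sublist (x :: l) ∧ (x :: t).Pairwise R :=
          fun ht hp hR => ⟨(ht.trans List.filter_sublist).cons_cons x, List.pairwise_cons.2
            ⟨fun y hy => hp y (List.mem_filter.1 (ht.subset hy)).2, hR⟩⟩
        rcases le_or_gt ((m + (n + 1)).choose m) (l.filter fun y => decide (c x y)).length
          with hle | hlt
        · rcases ihm (n + 1) hle with ⟨t, ht, hlen, hc⟩ | ⟨t, ht, hlen, hc⟩
          · obtain ⟨hsub, hpair⟩ := hcons ht (fun y => of_decide_eq_true) hc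
            exact Or.inl ⟨x :: t, hsub, congrArg Nat.succ hlen, hpair⟩
          · exact Or.inr ⟨t, (ht.trans List.filter_sublist).cons x, hlen, hc⟩
        · rcases ihn (l := l.filter fun y => !decide (c x y)) (by lia) with
            ⟨t, ht, hlen, hc⟩ | ⟨t, ht, hlen, hc⟩
          · exact Or.inl ⟨t, (ht.trans List.filter_sublist).cons x, hlen, hc⟩
          · obtain ⟨hsub, hpair⟩ := hcons ht (fun y hy => by simpa using hy) hc
            exact Or.inr ⟨x :: t, hsub, congrArg Nat.succ hlen, hpair⟩

variable {V V' W W' : Type*} {R : V → W → Prop}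

/-- The pairs `(a, b)` in `l` form a half-graph for `R`: for two of them, `R a b'` holds if
`(a, b)` comes before `(a', b')` and fails if it comes after. -/
def IsLadder (R : V → W → Prop) (l : List (V × W)) : Prop :=
  l.Pairwise fun p q => R p.1 q.2 ∧ ¬ R q.1 p.2

/-- The ladders for `R` have bounded length, i.e. `R` is stable. -/
def BoundedLadders (R : V → W → Prop) : Prop :=
  ∃ N, ∀ l, IsLadder R l → l.length < N

theorem IsLadder.reverse {l : List (V × W)} (h : IsLadder R l) :
    IsLadder (fun v w => ¬ R v w) l.reverse :=
  List.pairwise_reverse.2 (h.imp fun hpq => ⟨hpq.2, not_not.2 hpq.1⟩)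

theorem BoundedLadders.not (h : BoundedLadders R) : BoundedLadders fun v w => ¬ R v w := by
  obtain ⟨N, h⟩ := h
  refine ⟨N, fun l hl => l.length_reverse.symm.trans_lt (h _ ?_)⟩
  simpa only [not_not] using hl.reverse

theorem BoundedLadders.comp (h : BoundedLadders R) (f : V' → V) (g : W' → W) :
    BoundedLadders fun v w => R (f v) (g w) := by
  obtain ⟨N, h⟩ := h
  exact ⟨N, fun l hl =>
    (List.length_map _).symm.trans_lt (h _ (hl.map (Prod.map f g) fun _ _ => id))⟩

theorem BoundedLadders.of_finite_coloring {κ : Type*} [Finite κ] (col : V → κ)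
    (h : ∃ N, ∀ i l, IsLadder R l → (∀ p ∈ l, col p.1 = i) → l.length < N) : BoundedLadders R := by
  obtain ⟨N, h⟩ := h
  have := Fintype.ofFinite κ
  refine ⟨(N + 1 + (Fintype.card κ + 1)).choose (N + 1), fun l hl => ?_⟩
  by_contra! hle
  rcases exists_pairwise_sublist (fun p q : V × W => col p.1 = col q.1) _ _ hle with
    ⟨t, ht, hlen, hcol⟩ | ⟨t, -, hlen, hcol⟩
  · obtain _ | ⟨p, t⟩ := t
    · exact absurd hlen (Nat.succ_ne_zero N).symm
    have hlt := h (col p.1) (p :: t) (hl.sublist ht) fun q hq => by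
      rcases List.mem_cons.1 hq with rfl | hq
      exacts [rfl, ((List.pairwise_cons.1 hcol).1 q hq).symm]
    lia
  · have hnodup : (t.map fun p => col p.1).Nodup := hcol.map _ fun _ _ => id
    have hcard := hnodup.length_le_card
    rw [List.length_map] at hcard
    lia

variable {Z : Type*} {S : V → W → Set Z}

theorem encard_inter_le_of_not_subset {A B : Set Z} {k : ℕ} (hB : B.encard ≤ (k + 1 : ℕ))
    (h : ¬ B ⊆ A) : (A ∩ B).encard ≤ k := by
  refine Order.le_of_lt_add_one (lt_of_lt_of_le ?_ hB)
  exact ((Set.finite_of_encard_le_coe hB).subset Set.inter_subset_right).encard_lt_encard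
    ⟨Set.inter_subset_right, fun hBA => h fun z hz => (hBA hz).1⟩

theorem exists_length_lt_of_encard_le
    (hC : ∀ j, BoundedLadders fun v (p : (Fin j → W) × W) => ⋂ i, S v (p.1 i) ⊆ S v p.2)
    (k j : ℕ) : ∃ N, ∀ (l : List ((Z × V) × W)) (w : Fin j → W),
      IsLadder (fun x w => x.1 ∈ S x.2 w) l → (∀ p ∈ l, p.1.1 ∈ ⋂ i, S p.1.2 (w i)) →
        (∀ p ∈ l, (⋂ i, S p.1.2 (w i)).encard ≤ k) → l.length < N := by
  induction k generalizing j with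
  | zero =>
    refine ⟨1, fun l w _ hmem hk => Nat.lt_one_iff.2 (List.length_eq_zero_iff.2 ?_)⟩
    refine List.eq_nil_iff_forall_not_mem.2 fun p hp => ?_
    exact (Set.encard_eq_zero.1 (nonpos_iff_eq_zero.1 (hk p hp))).subset (hmem p hp)
  | succ k ih =>
    obtain ⟨N₁, h₁⟩ := hC j
    obtain ⟨N₂, h₂⟩ := ih (j + 1)
    refine ⟨(N₁ + (N₂ + 1)).choose N₁, fun l w hl hmem hk => ?_⟩
    by_contra! hle
    rcases exists_pairwise_sublist (fun p q => ⋂ i, S p.1.2 (w i) ⊆ S p.1.2 q.2) N₁ _ hle with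
      ⟨t, ht, hlen, hsub⟩ | ⟨t, ht, hlen, hsub⟩
    · have hladder := (hsub.and (hl.sublist ht)).imp_of_mem
        (S := fun p q => ⋂ i, S p.1.2 (w i) ⊆ S p.1.2 q.2 ∧ ¬ ⋂ i, S q.1.2 (w i) ⊆ S q.1.2 p.2)
        fun _ hq h => ⟨h.1, fun hqp => h.2.2 (hqp (hmem _ (ht.subset hq)))⟩
      refine (h₁ (t.map fun p => (p.1.2, w, p.2)) (hladder.map _ fun _ _ => id)).ne ?_
      rw [List.length_map, hlen]
    · obtain rfl | ⟨t, q, rfl⟩ := t.eq_nil_or_concat'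
      · exact absurd hlen (Nat.succ_ne_zero N₂).symm
      have hcons : ∀ v, ⋂ i, S v (Fin.cons (α := fun _ => W) q.2 w i) =
          S v q.2 ∩ ⋂ i, S v (w i) := fun v => by
        ext z
        simp only [Set.mem_iInter, Fin.forall_fin_succ, Fin.cons_zero, Fin.cons_succ,
          Set.mem_inter_iff]
      obtain ⟨hladder, -, hlast⟩ := List.pairwise_append.1 (hl.sublist ht)
      have hleft : ∀ p ∈ t, p ∈ l := fun p hp => ht.subset (List.mem_append_left _ hp)
      refine (h₂ t (Fin.cons q.2 w) hladder (fun p hp => ?_) fun p hp => ?_).ne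
        (by simpa using hlen)
      · rw [hcons]
        exact ⟨(hlast p hp q (List.mem_singleton_self q)).1, hmem p (hleft p hp)⟩
      · rw [hcons]
        exact encard_inter_le_of_not_subset (hk p (hleft p hp))
          ((List.pairwise_append.1 hsub).2.2 p hp q (List.mem_singleton_self q))

theorem exists_length_concat_lt_of_encard_le
    (hC : ∀ j, BoundedLadders fun v (p : (Fin j → W) × W) => ⋂ i, S v (p.1 i) ⊆ S v p.2) (k : ℕ) :
    ∃ N, ∀ (l : List ((Z × V) × W)) (w : W), IsLadder (fun x w => x.1 ∈ S x.2 w) l →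
      (∀ p ∈ l, p.1.1 ∈ S p.1.2 w) → (∀ p ∈ l, (S p.1.2 w).encard ≤ k) → l.length < N := by
  obtain ⟨N, h⟩ := exists_length_lt_of_encard_le hC k 1
  exact ⟨N, fun l w => by simpa only [Set.iInter_const] using h l fun _ => w⟩

theorem BoundedLadders.of_encard_le {k : ℕ}
    (hk : ∀ v w, (S v w).encard ≤ k ∨ (S v w)ᶜ.encard ≤ k)
    (hsmall : BoundedLadders fun v w => (S v w).encard ≤ k)
    (hC : ∀ j, BoundedLadders fun v (p : (Fin j → W) × W) => ⋂ i, S v (p.1 i) ⊆ S v p.2)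
    (hC' : ∀ j, BoundedLadders fun v (p : (Fin j → W) × W) => ⋂ i, (S v (p.1 i))ᶜ ⊆ (S v p.2)ᶜ) :
    BoundedLadders fun (x : Z × V) w => x.1 ∈ S x.2 w := by
  obtain ⟨N₀, h₀⟩ := hsmall.not
  obtain ⟨N₁, h₁⟩ := exists_length_concat_lt_of_encard_le hC k
  obtain ⟨N₂, h₂⟩ := exists_length_concat_lt_of_encard_le (S := fun v w => (S v w)ᶜ) hC' k
  refine ⟨(N₁ + 1 + (N₀ + (N₂ + 1)).choose N₀).choose (N₁ + 1), fun l hl => ?_⟩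
  by_contra! hle
  rcases exists_pairwise_sublist (fun p q => (S p.1.2 q.2).encard ≤ k) (N₁ + 1) _ hle with
    ⟨t, ht, hlen, hc⟩ | ⟨t, ht, hlen, hc⟩
  · obtain rfl | ⟨t, q, rfl⟩ := t.eq_nil_or_concat'
    · exact absurd hlen (Nat.succ_ne_zero N₁).symm
    obtain ⟨hladder, -, hlast⟩ := List.pairwise_append.1 (hl.sublist ht)
    refine (h₁ t q.2 hladder (fun p hp => (hlast p hp q (List.mem_singleton_self q)).1)
      fun p hp => (List.pairwise_append.1 hc).2.2 p hp q (List.mem_singleton_self q)).ne ?_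
    simpa using hlen
  rcases exists_pairwise_sublist (fun p q => (S q.1.2 p.2).encard ≤ k) N₀ (N₂ + 1) hlen.ge with
    ⟨t', ht', hlen', hc'⟩ | ⟨t', ht', hlen', hc'⟩
  · refine (h₀ (t'.map fun p => (p.1.2, p.2)) (((hc.sublist ht').and hc').map _
      fun _ _ h => ⟨h.1, not_not.2 h.2⟩)).ne ?_
    rw [List.length_map, hlen']
  · obtain _ | ⟨q, t'⟩ := t'
    · exact absurd hlen' (Nat.succ_ne_zero N₂).symm
    obtain ⟨hfirst, hladder⟩ := List.pairwise_cons.1 (hl.sublist (ht'.trans ht))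
    refine (h₂ t'.reverse q.2 (IsLadder.reverse hladder) (fun p hp => ?_) fun p hp => ?_).ne ?_
    · exact (hfirst p (List.mem_reverse.1 hp)).2
    · exact (hk _ _).resolve_left ((List.pairwise_cons.1 hc').1 p (List.mem_reverse.1 hp))
    · simpa using hlen'

end Ladder

section Stability

variable {L : FirstOrder.Language} {G : Type*} [L.Structure G]

theorem IsStableStructure.not_forall_exists_lt_iff (h : IsStableStructure L G) {m : ℕ}
    {R : (Fin m → G) → (Fin m → G) → Prop}
    (hR : DefinableRel L fun w : Fin m ⊕ Fin m → G =>
      R (fun i => w (Sum.inl i)) fun i => w (Sum.inr i)) :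
    ¬ ∀ N : ℕ, ∃ a b : Fin N → Fin m → G, ∀ i j, R (a i) (b j) ↔ i < j := by
  obtain ⟨n, c, φ, hφ⟩ := hR.exists_params
  obtain ⟨N, hN⟩ := h m (n + m) (φ.relabel (Sum.elim (fun x => Sum.inr (Fin.castAdd m x))
    (Sum.elim Sum.inl fun x => Sum.inr (Fin.natAdd n x))))
  refine fun hall => ?_
  obtain ⟨a, b, hab⟩ := hall N
  refine hN ⟨a, fun j => Fin.append c (b j), fun i j => ?_⟩
  rw [← hab, Formula.realize_relabel]
  refine Iff.trans (iff_of_eq (congrArg _ (funext fun x => ?_))) (hφ (Sum.elim (a i) (b j)))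
  rcases x with x | x | x <;> simp

theorem DefinableRel.cons_left {m : ℕ} {β γ : Type*} [Finite β]
    {R : (Fin (m + 1) → G) → (β → G) → Prop}
    (hR : DefinableRel L fun w : Fin (m + 1) ⊕ β → G =>
      R (fun i => w (Sum.inl i)) fun i => w (Sum.inr i))
    {F : (γ → G) → G} (hF : DefinableMap L F) (e : Fin m → γ) (e' : β → γ) :
    DefinableRel L fun w => R (Fin.cons (F w) fun i => w (e i)) fun i => w (e' i) := by
  refine (CoDefinable.comp hR (F := Sum.elim (Fin.cons F fun i w => w (e i)) fun i w => w (e' i))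
    (F' := Sum.elim (Fin.cons F fun i w => w (e i)) fun i w => w (e' i)) ?_).congr ?_ ?_
  · exact Sum.forall.2 ⟨Fin.cases hF fun i => CoDefinableFun.proj _,
      fun i => CoDefinableFun.proj _⟩
  all_goals
    intro w
    refine iff_of_eq (congrArg (fun v => R v _) (funext fun i => ?_))
    cases i using Fin.cases <;> rfl

/-- The definable relations between `m`-tuples and other finite tuples have bounded ladders. -/
def HasBoundedLadders (L : FirstOrder.Language) (G : Type*) [L.Structure G] (m : ℕ) : Prop :=
  ∀ ⦃β : Type⦄ [Finite β] (R : (Fin m → G) → (β → G) → Prop),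
    DefinableRel L (fun w : Fin m ⊕ β → G => R (fun i => w (Sum.inl i)) fun i => w (Sum.inr i)) →
      BoundedLadders R

theorem hasBoundedLadders_zero : HasBoundedLadders L G 0 := by
  intro β _ R _
  refine ⟨3, fun l hl => ?_⟩
  rcases l with _ | ⟨p, _ | ⟨q, _ | ⟨r, l⟩⟩⟩
  · simp
  · simp
  · simp
  obtain ⟨hp, hqr⟩ := List.pairwise_cons.1 hl
  have hpq := (hp q List.mem_cons_self).1
  have hrq := ((List.pairwise_cons.1 hqr).1 r List.mem_cons_self).2
  exact absurd (Subsingleton.elim p.1 r.1 ▸ hpq) hrq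

theorem HasBoundedLadders.of_encard_le {m : ℕ} (h : HasBoundedLadders L G m) {β : Type} [Finite β]
    {S : (Fin m → G) → (β → G) → Set G}
    (hS : DefinableFamily L fun w : Fin m ⊕ β → G =>
      S (fun i => w (Sum.inl i)) fun i => w (Sum.inr i)) {k : ℕ}
    (hk : ∀ v w, (S v w).encard ≤ k ∨ (S v w)ᶜ.encard ≤ k) :
    BoundedLadders fun (x : G × (Fin m → G)) w => x.1 ∈ S x.2 w := by
  have hC : ∀ {T : (Fin m → G) → (β → G) → Set G}, (DefinableFamily L fun w : Fin m ⊕ β → G =>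
      T (fun i => w (Sum.inl i)) fun i => w (Sum.inr i)) → ∀ j,
        BoundedLadders fun v (p : (Fin j → β → G) × (β → G)) => ⋂ i, T v (p.1 i) ⊆ T v p.2 := by
    intro T hT j
    have hdef : DefinableRel L fun w : Fin m ⊕ (Fin j × β ⊕ β) → G =>
        ∀ z, (∀ i, z ∈ T (fun i => w (Sum.inl i)) fun o => w (Sum.inr (Sum.inl (i, o)))) →
          z ∈ T (fun i => w (Sum.inl i)) fun o => w (Sum.inr (Sum.inr o)) :=
      CoDefinable.forall <| (CoDefinable.finite_forall fun i =>
        hT.relabel fun o : Option (Fin m ⊕ β) => o.elim none fun x => some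
          (x.map id fun o => Sum.inl (i, o))).imp <|
        hT.relabel fun o : Option (Fin m ⊕ β) => o.elim none fun x => some (x.map id Sum.inr)
    have hladders := (h (fun v u => ∀ z, (∀ i, z ∈ T v fun o => u (Sum.inl (i, o))) →
      z ∈ T v fun o => u (Sum.inr o)) hdef).comp id
      fun p : (Fin j → β → G) × (β → G) => Sum.elim (fun q => p.1 q.1 q.2) p.2
    simpa only [Set.subset_def, Set.mem_iInter] using! hladders
  exact .of_encard_le hk (h _ (hS.encard_le k)) (hC hS) (hC (T := fun v w => (S v w)ᶜ) hS.not)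

variable [AddCommGroup G]

/-- On every coset of some `nG`, the members of a definable family of subsets of `G` are of
bounded size or have complements of bounded size. -/
def UniformlySmall (L : FirstOrder.Language) (G : Type*) [L.Structure G] [AddCommGroup G] : Prop :=
  ∀ ⦃β : Type⦄ [Finite β] (S : (β → G) → Set G), DefinableFamily L S →
    ∃ n : ℕ, 0 < n ∧ ∃ k : ℕ, ∀ b c,
      {y | c + n • y ∈ S b}.encard ≤ k ∨ {y | c + n • y ∈ S b}ᶜ.encard ≤ k

theorem UniformlySmall.hasBoundedLadders_succ (h : UniformlySmall L G)
    (hadd : AddCoDefinable L (id : G → G) (id : G → G)) (hG : HasSmallQuotients G) {m : ℕ}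
    (hm : HasBoundedLadders L G m) : HasBoundedLadders L G (m + 1) := by
  intro β _ R hR
  obtain ⟨n, hn, k, hk⟩ := h (fun w : Fin m ⊕ β → G =>
    {y | R (Fin.cons y fun i => w (Sum.inl i)) fun i => w (Sum.inr i)})
    (hR.cons_left (CoDefinableFun.proj none) _ _)
  obtain ⟨N, hN⟩ := hm.of_encard_le (k := k)
    (S := fun v (w : Option β → G) => {y | R (Fin.cons (w none + n • y) v) fun i => w (some i)})
    (hR.cons_left ((CoDefinableFun.proj _).add hadd ((CoDefinableFun.proj none).nsmul hadd n)) _ _)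
    fun v w => hk (Sum.elim v fun i => w (some i)) (w none)
  obtain ⟨q, r, hr⟩ := hasSmallQuotients_iff_hasCosetReps.1 hG n hn
  choose col y hy using hr
  refine BoundedLadders.of_finite_coloring (fun v : Fin (m + 1) → G => col (v 0))
    ⟨N, fun i l hl hcol => ?_⟩
  have hself : ∀ p ∈ l, Fin.cons (r i + n • y (p.1 0)) (Fin.tail p.1) = p.1 := fun p hp => by
    rw [← hcol p hp, ← hy, Fin.cons_self_tail]
  refine (List.length_map _).symm.trans_lt (hN (l.map fun p =>
    ((y (p.1 0), Fin.tail p.1), fun o => o.elim (r i) p.2)) (List.pairwise_map.2 ?_))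
  refine hl.imp_of_mem fun {p q} hp hq hpq => ?_
  change R (Fin.cons (r i + n • y (p.1 0)) (Fin.tail p.1)) q.2 ∧
    ¬ R (Fin.cons (r i + n • y (q.1 0)) (Fin.tail q.1)) p.2
  rwa [hself p hp, hself q hq]

theorem UniformlySmall.isStableStructure (h : UniformlySmall L G)
    (hadd : AddCoDefinable L (id : G → G) (id : G → G)) (hG : HasSmallQuotients G) :
    IsStableStructure L G := by
  have hladders : ∀ m, HasBoundedLadders L G m := by
    intro m
    induction m with
    | zero => exact hasBoundedLadders_zero
    | succ m ih => exact h.hasBoundedLadders_succ hadd hG ih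
  intro m n φ
  obtain ⟨N, hN⟩ := hladders m (fun v w => φ.Realize (Sum.elim v w)) <| by
    refine (DefinableRel.of_formula φ).congr ?_ ?_ <;>
    · intro w
      exact iff_of_eq (congrArg _ (Sum.elim_comp_inl_inr w).symm)
  refine ⟨N, fun ⟨a, b, hab⟩ => ?_⟩
  refine (hN (List.ofFn fun i => (a i, b i)) (List.pairwise_ofFn.2 fun i j hij => ?_)).ne
    List.length_ofFn
  exact ⟨(hab i j).2 hij, fun hji => hij.asymm ((hab j i).1 hji)⟩

end Stability

/-! ### Runs of a finite set -/

section Runs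

variable {G : Type*} [AddCommGroup G] {u y : G} {E : Set G}

/-- The right ends of the maximal runs `y, y + u, y + 2 • u, …` inside `E`. -/
def runEnds (u : G) (E : Set G) : Set G :=
  {y ∈ E | y + u ∉ E}

/-- What is left of `E` when the last `l` points of each maximal run are removed. -/
def erosion (u : G) (l : ℕ) (E : Set G) : Set G :=
  {y | ∀ i ≤ l, y + i • u ∈ E}

theorem runEnds_subset : runEnds u E ⊆ E := fun _ hy => hy.1

theorem erosion_subset (l : ℕ) : erosion u l E ⊆ E := fun y hy => by
  simpa only [zero_smul, add_zero] using hy 0 l.zero_le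

theorem erosion_erosion (i l : ℕ) : erosion u i (erosion u l E) = erosion u (l + i) E := by
  ext y
  constructor
  · intro hy j hj
    have := hy (j - l) (by lia) (min j l) (min_le_right _ _)
    rwa [add_assoc, ← add_smul, Nat.sub_add_min_cancel] at this
  · intro hy j hj k hk
    have := hy (k + j) (by lia)
    rwa [add_smul, add_comm (k • u), ← add_assoc] at this

theorem exists_add_nsmul_mem_runEnds (hy : y ∈ E) {j : ℕ} (hj : y + j • u ∉ E) :
    ∃ i < j, y + i • u ∈ runEnds u E := by
  induction j with
  | zero => exact absurd hy (by simpa only [zero_smul, add_zero] using hj)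
  | succ j ih =>
    by_cases hmem : y + j • u ∈ E
    · exact ⟨j, j.lt_succ_self, hmem, by rwa [add_assoc, ← succ_nsmul]⟩
    · obtain ⟨i, hi, h⟩ := ih hmem
      exact ⟨i, hi.trans j.lt_succ_self, h⟩

theorem exists_add_nsmul_mem_runEnds_of_finite (hu : Function.Injective fun i : ℕ => i • u)
    (hE : E.Finite) (hy : y ∈ E) : ∃ i : ℕ, y + i • u ∈ runEnds u E := by
  have hinf : (Set.range fun i : ℕ => y + i • u).Infinite :=
    Set.infinite_range_of_injective ((add_right_injective y).comp hu)
  obtain ⟨_, ⟨j, rfl⟩, hj⟩ := hinf.exists_notMem_finite hE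
  obtain ⟨i, -, hi⟩ := exists_add_nsmul_mem_runEnds hy hj
  exact ⟨i, hi⟩

/- The point `p` is forced to be the left end of the finite set `S v`, which is then the only place
where the walk from `p + x` in steps of `-u` can leave `S v`. -/
theorem exists_eq_nsmul_iff_of_segments (hu : Function.Injective fun i : ℕ => i • u) {ι : Type*}
    {S : ι → Set G} (hfin : ∀ v, (S v).Finite)
    (hseg : ∀ i : ℕ, ∃ v p, S v = {x | ∃ j ≤ i, x = p + j • u}) {x : G} :
    (∃ v p, (∀ q, q ∈ S v → q - u ∉ S v → q = p) ∧ p + x ∈ S v) ↔ ∃ i : ℕ, x = i • u := by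
  refine ⟨fun ⟨v, p, hp, hx⟩ => ?_, fun ⟨i, hi⟩ => ?_⟩
  · have hneg : Function.Injective fun i : ℕ => i • -u := fun i j hij =>
      hu (neg_injective (by simpa only [smul_neg] using hij))
    obtain ⟨i, hi⟩ := exists_add_nsmul_mem_runEnds_of_finite hneg (hfin v) hx
    have hpi := hp _ hi.1 (by simpa only [sub_eq_add_neg] using hi.2)
    rw [add_assoc, smul_neg, ← sub_eq_add_neg] at hpi
    exact ⟨i, sub_eq_zero.1 (add_eq_left.1 hpi)⟩
  · obtain ⟨v, p, hSv⟩ := hseg i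
    refine ⟨v, p, fun q hq hqu => ?_, hSv ▸ ⟨i, le_rfl, hi ▸ rfl⟩⟩
    rw [hSv] at hq hqu
    obtain ⟨j | j, hj, rfl⟩ := hq
    · rw [zero_smul, add_zero]
    · refine absurd ⟨j, (Nat.le_succ j).trans hj, ?_⟩ hqu
      rw [succ_nsmul, ← add_assoc, add_sub_cancel_right]

theorem ncard_le_of_erosion_eq_empty (hE : E.Finite) {l : ℕ} (h : erosion u l E = ∅) :
    E.ncard ≤ l * (runEnds u E).ncard := by
  have hcover : E ⊆ (fun q : ℕ × G => q.2 - q.1 • u) '' (Set.Iio l ×ˢ runEnds u E) := by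
    intro y hy
    have hy' : y ∉ erosion u l E := h ▸ Set.notMem_empty y
    simp only [erosion, Set.mem_ofPred_eq, not_forall] at hy'
    obtain ⟨j, hjl, hj⟩ := hy'
    obtain ⟨i, hij, hi⟩ := exists_add_nsmul_mem_runEnds hy hj
    exact ⟨(i, y + i • u), ⟨hij.trans_le hjl, hi⟩, add_sub_cancel_right y _⟩
  have hfin := (Set.finite_Iio l).prod (hE.subset (runEnds_subset (u := u)))
  calc E.ncard ≤ _ := Set.ncard_le_ncard hcover (hfin.image _)
    _ ≤ _ := Set.ncard_image_le hfin
    _ = l * (runEnds u E).ncard := by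
      rw [Set.ncard_prod, Set.ncard_eq_toFinset_card', Set.toFinset_Iio, Nat.card_Iio]

theorem ncard_runEnds_erosion_lt (hE : E.Finite) {q : G} (hq : q ∈ runEnds u E) {i j : ℕ}
    (hji : j ≤ i) (hj : q - j • u ∉ E) :
    (runEnds u (erosion u i E)).ncard < (runEnds u E).ncard := by
  have hends : (runEnds u E).Finite := hE.subset runEnds_subset
  rw [← Set.ncard_image_of_injective _ (add_left_injective (i • u)),
    ← Set.ncard_sdiff_singleton_add_one hq hends, Nat.lt_succ_iff]
  refine Set.ncard_le_ncard (Set.image_subset_iff.2 fun y hy => ⟨⟨hy.1 i le_rfl, ?_⟩, ?_⟩)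
    (hends.subset Set.sdiff_subset)
  · refine fun hnext => hy.2 fun k hk => ?_
    rw [add_right_comm] at hnext
    rcases hk.eq_or_lt with rfl | hk
    · exact hnext
    · have := hy.1 (k + 1) hk
      rwa [succ_nsmul', ← add_assoc] at this
  · rintro (rfl : y + i • u = q)
    have := hy.1 (i - j) (Nat.sub_le i j)
    rw [sub_nsmul _ hji, ← add_assoc, ← sub_eq_add_neg] at this
    exact hj this

/- Eroding by the length of a short run removes that run without creating a new one, which can
happen at most `K` times. -/
theorem exists_forall_long_runs {ι : Type*} {F : ι → Set G} (hF : ∀ v, (F v).Finite) {K : ℕ}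
    (h : ∀ l, ∃ v, (erosion u l (F v)).Nonempty ∧ (runEnds u (F v)).ncard < K) :
    ∃ s, ∀ i : ℕ, ∃ v, (erosion u s (F v)).Nonempty ∧
      ∀ q ∈ runEnds u (erosion u s (F v)), ∀ j ≤ i, q - j • u ∈ erosion u s (F v) := by
  by_contra! hshort
  have herode : ∀ K s, ¬ ∀ l, ∃ v, (erosion u l (F v)).Nonempty ∧
      (runEnds u (erosion u s (F v))).ncard < K := by
    intro K
    induction K with
    | zero => exact fun s hs => (hs 0).elim fun v hv => Nat.not_lt_zero _ hv.2
    | succ K ih =>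
      intro s hs
      obtain ⟨i, hi⟩ := hshort s
      refine ih (s + i) fun l => ?_
      obtain ⟨v, ⟨y, hy⟩, hlt⟩ := hs (max l s)
      refine ⟨v, ⟨y, fun j hj => hy j (hj.trans (le_max_left _ _))⟩, ?_⟩
      obtain ⟨q, hq, j, hji, hj⟩ := hi v ⟨y, fun j hj => hy j (hj.trans (le_max_right _ _))⟩
      rw [← erosion_erosion]
      exact (ncard_runEnds_erosion_lt ((hF v).subset (erosion_subset s)) hq hji hj).trans_le
        (Nat.lt_succ_iff.1 hlt)
  refine herode K 0 fun l => ?_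
  simpa only [erosion, Nat.le_zero, forall_eq, zero_smul, add_zero, Set.ofPred_mem_eq] using h l

variable [LinearOrder G] [IsOrderedAddMonoid G]

/- The translate of `E` moves its minimum to the point `i` steps before its maximum, so that only
these `i + 1` points are common to both. -/
theorem exists_inter_translate_eq (hu : IsLeast (Set.Ioi 0) u) (hE : E.Finite)
    (hne : E.Nonempty) {i : ℕ} (hlong : ∀ q ∈ runEnds u E, ∀ j ≤ i, q - j • u ∈ E) :
    ∃ p d, {x ∈ E | x - d ∈ E} = {x | ∃ j ≤ i, x = p + j • u} := by
  obtain ⟨a, ha, hmin⟩ := Set.exists_min_image E id hE hne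
  obtain ⟨b, hb, hmax⟩ := Set.exists_max_image E id hE hne
  have hbE : ∀ j ≤ i, b - j • u ∈ E :=
    hlong b ⟨hb, fun h => (hmax _ h).not_gt (lt_add_of_pos_right b hu.1)⟩
  have haE : ∀ j ≤ i, a + j • u ∈ E := by
    intro j hj
    by_contra hjE
    obtain ⟨k, hkj, hk⟩ := exists_add_nsmul_mem_runEnds ha hjE
    have := hlong _ hk (k + 1) (by lia)
    rw [succ_nsmul, ← sub_sub, add_sub_cancel_right] at this
    exact (hmin _ this).not_gt (sub_lt_self a hu.1)
  refine ⟨b - i • u, b - i • u - a, Set.ext fun x => ⟨fun ⟨hx, hxd⟩ => ?_, ?_⟩⟩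
  · have hax : a ≤ x - (b - i • u - a) := hmin _ hxd
    have hxb : x ≤ b := hmax x hx
    obtain ⟨j, hj, hxj⟩ := exists_eq_nsmul_of_isLeast hu (N := i) (z := x - (b - i • u))
      (by grind) (by grind)
    exact ⟨j, hj, sub_eq_iff_eq_add'.1 hxj⟩
  · rintro ⟨j, hj, rfl⟩
    constructor
    · have := hbE (i - j) (Nat.sub_le i j)
      rwa [sub_nsmul _ hj, ← sub_sub, sub_neg_eq_add] at this
    · convert haE j hj using 1
      abel

end Runs

/-! ### Finite or cofinite sets -/

/-- The definable subsets of `G` that are determined by the signs of finitely many affine functions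
are finite or cofinite. This is the common consequence of the conditions of the theorem from which
each of them follows. -/
def IsSignMinimal (L : FirstOrder.Language) (G : Type*) [L.Structure G] [AddCommGroup G]
    [LinearOrder G] : Prop :=
  ∀ (E : Set G) (r : ℕ), DefinableRel L (fun v : Unit → G => v () ∈ E) → IsSignDetermined r E →
    E.Finite ∨ Eᶜ.Finite

/-- The set `E` itself if `E` is finite, and `∅` if `E` is cofinite in an infinite group. In
contrast to finiteness, the defining condition can be expressed by a formula about `E`. -/
def finitePart {G : Type*} [AddCommGroup G] (E : Set G) : Set G :=
  {y ∈ E | ∃ d, ∀ x ∈ E, x - d ∉ E}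

section FinitePart

variable {G : Type*} [AddCommGroup G] [Infinite G] {E : Set G}

theorem finitePart_eq_self (hE : E.Finite) : finitePart E = E := by
  obtain ⟨d, hd⟩ := ((hE.prod hE).image fun p : G × G => p.1 - p.2).exists_notMem
  exact Set.sep_eq_self_iff_mem_true.2 fun _ _ =>
    ⟨d, fun x hx hxd => hd ⟨(x, x - d), ⟨hx, hxd⟩, sub_sub_cancel x d⟩⟩

theorem finitePart_eq_empty (hE : Eᶜ.Finite) : finitePart E = ∅ := by
  refine Set.sep_eq_empty_iff_mem_false.2 fun y _ ⟨d, hd⟩ => ?_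
  obtain ⟨x, hx⟩ := (hE.union (hE.preimage (sub_left_injective (b := d)).injOn)).exists_notMem
  rw [Set.mem_union, not_or, Set.notMem_compl_iff, Set.mem_preimage, Set.notMem_compl_iff] at hx
  exact hd x hx.1 hx.2

theorem finite_finitePart (hE : E.Finite ∨ Eᶜ.Finite) : (finitePart E).Finite := by
  rcases hE with hE | hE
  · rwa [finitePart_eq_self hE]
  · rw [finitePart_eq_empty hE]
    exact Set.finite_empty

end FinitePart

section SignMinimal

variable {L : FirstOrder.Language} {G : Type*} [L.Structure G]

theorem DefinableFamily.definableRel_mem {γ : Type*} [Finite γ] {F : (γ → G) → Set G}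
    (hF : DefinableFamily L F) (v : γ → G) : DefinableRel L fun w : Unit → G => w () ∈ F v :=
  hF.mem (CoDefinableFun.proj ()) fun i => DefinableMap.const (v i)

variable [AddCommGroup G]

theorem DefinableFamily.erosion {γ : Type*} [Finite γ] {F : (γ → G) → Set G}
    (hF : DefinableFamily L F) (hadd : AddCoDefinable L (id : G → G) (id : G → G)) (u : G) (l : ℕ) :
    DefinableFamily L fun v => erosion u l (F v) := by
  have hall : DefinableRel L fun w : Option γ → G =>
      ∀ i : Set.Iic l, w none + (i : ℕ) • u ∈ F fun j => w (some j) :=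
    CoDefinable.finite_forall fun i =>
      hF.mem_comp some ((CoDefinableFun.proj none).add hadd (DefinableMap.const _))
  exact hall.congr (fun _ => Subtype.forall) (fun _ => Subtype.forall)

theorem DefinableFamily.finitePart {γ : Type*} [Finite γ] {F : (γ → G) → Set G}
    (hF : DefinableFamily L F) (hadd : AddCoDefinable L (id : G → G) (id : G → G)) :
    DefinableFamily L fun v => finitePart (F v) :=
  CoDefinable.and hF <| CoDefinable.exists <| CoDefinable.forall <| CoDefinable.imp
    (hF.mem_comp (fun i => some (some (some i))) (CoDefinableFun.proj none))
    (hF.mem_comp (fun i => some (some (some i)))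
      ((CoDefinableFun.proj none).sub hadd (CoDefinableFun.proj (some none)))).not

theorem definableRel_nsmul_of_segments (hadd : AddCoDefinable L (id : G → G) (id : G → G)) {u : G}
    (hu : Function.Injective fun i : ℕ => i • u) {γ : Type} [Finite γ] {S : (γ → G) → Set G}
    (hS : DefinableFamily L S) (hfin : ∀ v, (S v).Finite)
    (hseg : ∀ i : ℕ, ∃ v p, S v = {x | ∃ j ≤ i, x = p + j • u}) :
    DefinableRel L fun v : Unit → G => ∃ i : ℕ, v () = i • u := by
  have hdef : DefinableRel L fun x : Unit → G => ∃ (v : γ → G) (p : G),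
      (∀ q, q ∈ S v → q - u ∉ S v → q = p) ∧ p + x () ∈ S v := by
    refine CoDefinable.exists_tuple (CoDefinable.exists (CoDefinable.and
      (CoDefinable.forall (CoDefinable.imp ?_ (CoDefinable.imp (CoDefinable.not ?_)
        (CoDefinable.eq (CoDefinableFun.proj none) (CoDefinableFun.proj (some none)))))) ?_))
    · exact hS.mem_comp (fun i => some (some (Sum.inr i))) (CoDefinableFun.proj none)
    · exact hS.mem_comp (fun i => some (some (Sum.inr i)))
        ((CoDefinableFun.proj none).sub hadd (DefinableMap.const u))
    · exact hS.mem_comp (fun i => some (Sum.inr i))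
        ((CoDefinableFun.proj none).add hadd (CoDefinableFun.proj (some (Sum.inl ()))))
  exact hdef.congr (fun _ => exists_eq_nsmul_iff_of_segments hu hfin hseg)
    (fun _ => exists_eq_nsmul_iff_of_segments hu hfin hseg)

variable [LinearOrder G] [IsOrderedAddMonoid G]

theorem definableRel_nsmul_of_few_runs (hadd : AddCoDefinable L (id : G → G) (id : G → G)) {u : G}
    (hu : IsLeast (Set.Ioi 0) u) {γ : Type} [Finite γ] {F : (γ → G) → Set G}
    (hF : DefinableFamily L F) (hfin : ∀ v, (F v).Finite) {K : ℕ}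
    (h : ∀ l, ∃ v, (erosion u l (F v)).Nonempty ∧ (runEnds u (F v)).ncard < K) :
    DefinableRel L fun v : Unit → G => ∃ i : ℕ, v () = i • u := by
  obtain ⟨s, hs⟩ := exists_forall_long_runs hfin h
  have hfin' : ∀ v, (erosion u s (F v)).Finite := fun v => (hfin v).subset (erosion_subset s)
  have hE := hF.erosion hadd u s
  refine definableRel_nsmul_of_segments hadd (nsmul_left_strictMono hu.1).injective
    (γ := Option γ) (S := fun w => {x ∈ erosion u s (F fun i => w (some i)) |
      x - w none ∈ erosion u s (F fun i => w (some i))}) ?_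
    (fun w => (hfin' _).subset (Set.sep_subset _ _)) fun i => ?_
  · exact CoDefinable.and (hE.mem_comp (fun i => some (some i)) (CoDefinableFun.proj none))
      (hE.mem_comp (fun i => some (some i))
        ((CoDefinableFun.proj none).sub hadd (CoDefinableFun.proj (some none))))
  · obtain ⟨v, hne, hlong⟩ := hs i
    obtain ⟨p, d, hpd⟩ := exists_inter_translate_eq hu (hfin' v) hne hlong
    exact ⟨fun o => o.elim d v, p, hpd⟩

theorem IsSignDetermined.encard_le_of_gaps {r : ℕ} {E R : Set G} (h : IsSignDetermined r E)
    (hRE : R ⊆ E) (hgap : ∀ y ∈ R, ∀ y' ∈ R, y < y' → ∃ z ∈ Set.Icc y y', z ∉ E) :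
    R.encard ≤ Nat.card (Fin r → SignType) := by
  obtain ⟨t, h⟩ := h
  have hmono := monotone_signs t
  have hstrict : StrictMonoOn (signs t) R := fun y hy y' hy' hlt => by
    refine (hmono hlt.le).lt_of_ne fun hs => ?_
    obtain ⟨z, hz, hzE⟩ := hgap y hy y' hy' hlt
    exact hzE (h y z ((hmono hz.1).antisymm ((hmono hz.2).trans_eq hs.symm)) (hRE hy))
  calc R.encard = (signs t '' R).encard := hstrict.injOn.encard_image.symm
    _ ≤ (Set.univ : Set (Fin r → SignType)).encard := Set.encard_le_encard (Set.subset_univ _)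
    _ = Nat.card (Fin r → SignType) := by rw [Set.encard_univ, ENat.card_eq_coe_natCard]

theorem IsSignDetermined.encard_le [DenselyOrdered G] {r : ℕ} {E : Set G}
    (h : IsSignDetermined r E) (hE : E.Finite) : E.encard ≤ Nat.card (Fin r → SignType) :=
  h.encard_le_of_gaps Set.Subset.rfl fun _ _ _ _ hlt =>
    Set.not_subset.1 fun hsub => Set.Icc_infinite hlt (hE.subset hsub)

theorem IsSignDetermined.encard_runEnds_le {r : ℕ} {E : Set G} (h : IsSignDetermined r E) {u : G}
    (hu : IsLeast (Set.Ioi 0) u) : (runEnds u E).encard ≤ Nat.card (Fin r → SignType) :=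
  h.encard_le_of_gaps runEnds_subset fun y hy _ _ hlt =>
    ⟨y + u, ⟨le_add_of_nonneg_right hu.1.le, le_sub_iff_add_le'.1 (hu.2 (sub_pos.2 hlt))⟩, hy.2⟩

theorem IsStableStructure.isSignMinimal (h : IsStableStructure L G)
    (hadd : AddCoDefinable L (id : G → G) (id : G → G)) (hr : IsRegularGroup G) :
    IsSignMinimal L G := by
  intro E r hE hdet
  by_contra! hinf
  have hR : DefinableRel L fun w : Fin 1 ⊕ Fin 1 → G => w (Sum.inl 0) + w (Sum.inr 0) ∈ E :=
    CoDefinable.comp hE fun _ => (CoDefinableFun.proj _).add hadd (CoDefinableFun.proj _)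
  refine h.not_forall_exists_lt_iff (R := fun x y => x 0 + y 0 ∈ E) hR fun N => ?_
  obtain ⟨p, w, hpw⟩ := hdet.exists_progression hr hinf.1 hinf.2 N
  refine ⟨fun i _ => p - (i : ℤ) • w, fun j _ => (j : ℤ) • w, fun i j => ?_⟩
  have hij := hpw (j - i : ℤ) (abs_le.2 ⟨by have := i.isLt; lia, by have := j.isLt; lia⟩)
  rw [sub_smul, add_sub_left_comm, add_comm] at hij
  rw [hij, sub_pos, Int.ofNat_lt, Fin.val_fin_lt]

theorem isSignMinimal_of_nsmul (hr : IsRegularGroup G)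
    (h : ∀ D : Set G, DefinableRel L (fun v : Unit → G => v () ∈ D) →
      ∃ m : ℕ, 0 < m ∧ ({y | m • y ∈ D}.Finite ∨ {y | m • y ∈ D}ᶜ.Finite)) :
    IsSignMinimal L G := by
  intro E r hE hdet
  obtain ⟨m, hm, hfin⟩ := h E hE
  by_contra! hinf
  rcases hfin with hfin | hfin
  · exact hdet.infinite_setOf_nsmul_mem hr hinf.1 hm hfin
  · exact hdet.compl.infinite_setOf_nsmul_mem hr hinf.2 hm hfin

theorem DefinableFamily.exists_isSignDetermined {β : Type*} {S : (β → G) → Set G}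
    (hS : DefinableFamily L S) (H : Interprets L ordGroupLang (id : G → G) (id : G → G))
    (hr : IsRegularGroup G) :
    ∃ n : ℕ, 0 < n ∧ ∃ r, ∀ (b : β → G) (c : G), IsSignDetermined r {y | c + n • y ∈ S b} :=
  (hr.determinedBy_sign (H.definableRel hS)).exists_isSignDetermined

theorem IsSignMinimal.not_definableRel_nsmul (h : IsSignMinimal L G)
    (hadd : AddCoDefinable L (id : G → G) (id : G → G))
    (H : Interprets L ordGroupLang (id : G → G) (id : G → G)) (hr : IsRegularGroup G) {u : G}
    (hu : 0 < u) : ¬ DefinableRel L fun v : Unit → G => ∃ i : ℕ, v () = i • u := by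
  intro hD
  have hS : DefinableFamily L fun _ : Empty → G => {y | ∃ i : ℕ, y = i • u} :=
    hD.relabel fun _ => none
  obtain ⟨n, hn, r, hdet⟩ := hS.exists_isSignDetermined H hr
  have hmono := nsmul_left_strictMono hu
  have hE := DefinableFamily.definableRel_mem (hS.affine_preimage hadd n) fun _ => 0
  rcases h {y | ∃ i : ℕ, 0 + n • y = i • u} r hE (hdet Empty.elim 0) with hfin | hfin
  · refine hfin.not_infinite
      (Set.infinite_of_injective_forall_mem hmono.injective fun j => ⟨n * j, ?_⟩)
    rw [zero_add, mul_smul]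
  · refine hfin.not_infinite (Set.infinite_of_injective_forall_mem
      (f := fun j : ℕ => -((j + 1) • u))
      (neg_injective.comp (hmono.injective.comp (add_left_injective 1))) fun j ⟨i, hi⟩ => ?_)
    rw [zero_add, smul_neg] at hi
    have hneg : 0 < n • (j + 1) • u := nsmul_pos (nsmul_pos hu j.succ_ne_zero) hn.ne'
    exact (neg_neg_of_pos hneg).not_ge (hi ▸ nsmul_nonneg hu.le i)

theorem IsSignMinimal.exists_encard_le (h : IsSignMinimal L G)
    (hadd : AddCoDefinable L (id : G → G) (id : G → G))
    (H : Interprets L ordGroupLang (id : G → G) (id : G → G)) (hr : IsRegularGroup G) {u : G}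
    (hu : IsLeast (Set.Ioi 0) u) {γ : Type} [Finite γ] {Q : (γ → G) → Set G}
    (hQ : DefinableFamily L Q) {r : ℕ} (hdet : ∀ v, IsSignDetermined r (Q v)) :
    ∃ k : ℕ, ∀ v, (Q v).Finite → (Q v).encard ≤ k := by
  have : Nontrivial G := ⟨⟨u, 0, hu.1.ne'⟩⟩
  by_contra! hbig
  refine h.not_definableRel_nsmul hadd H hr hu.1 (definableRel_nsmul_of_few_runs hadd hu
    (hQ.finitePart hadd) (fun v => finite_finitePart (h _ r (hQ.definableRel_mem v) (hdet v)))
    (K := Nat.card (Fin r → SignType) + 1) fun l => ?_)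
  obtain ⟨v, hfin, hl⟩ := hbig (l * Nat.card (Fin r → SignType))
  rw [← hfin.cast_ncard_eq, Nat.cast_lt] at hl
  have hends : (runEnds u (Q v)).ncard ≤ Nat.card (Fin r → SignType) := by
    have := (hdet v).encard_runEnds_le hu
    rwa [← (hfin.subset runEnds_subset).cast_ncard_eq, Nat.cast_le] at this
  refine ⟨v, ?_⟩
  rw [finitePart_eq_self hfin]
  refine ⟨?_, Nat.lt_succ_of_le hends⟩
  by_contra! hempty
  exact hl.not_ge ((ncard_le_of_erosion_eq_empty hfin hempty).trans (Nat.mul_le_mul_left l hends))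

theorem IsSignMinimal.uniformlySmall (h : IsSignMinimal L G)
    (hadd : AddCoDefinable L (id : G → G) (id : G → G))
    (H : Interprets L ordGroupLang (id : G → G) (id : G → G)) (hr : IsRegularGroup G) :
    UniformlySmall L G := by
  intro β _ S hS
  obtain ⟨n, hn, r, hdet⟩ := hS.exists_isSignDetermined H hr
  have hQ : DefinableFamily L fun v : Option β → G =>
      {y | v none + n • y ∈ S fun i => v (some i)} := hS.affine_preimage hadd n
  have hfin : ∀ b c, {y | c + n • y ∈ S b}.Finite ∨ {y | c + n • y ∈ S b}ᶜ.Finite := fun b c =>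
    h _ r (hQ.definableRel_mem fun o => o.elim c b) (hdet b c)
  refine ⟨n, hn, ?_⟩
  by_cases hu : ∃ u : G, IsLeast (Set.Ioi 0) u
  · obtain ⟨u, hu⟩ := hu
    obtain ⟨k₁, h₁⟩ := h.exists_encard_le hadd H hr hu hQ fun v => hdet _ _
    obtain ⟨k₂, h₂⟩ := h.exists_encard_le hadd H hr hu hQ.compl fun v => (hdet _ _).compl
    refine ⟨max k₁ k₂, fun b c => (hfin b c).imp (fun hf => ?_) fun hf => ?_⟩
    · exact (h₁ (fun o => o.elim c b) hf).trans (Nat.cast_le.2 (le_max_left _ _))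
    · exact (h₂ (fun o => o.elim c b) hf).trans (Nat.cast_le.2 (le_max_right _ _))
  · have := denselyOrdered_of_not_exists_isLeast hu
    exact ⟨_, fun b c => (hfin b c).imp (hdet b c).encard_le (hdet b c).compl.encard_le⟩

end SignMinimal

theorem UniformlySmall.of_subsingleton {L : FirstOrder.Language} {G : Type*} [L.Structure G]
    [AddCommGroup G] [Subsingleton G] : UniformlySmall L G := fun _ _ _ _ =>
  ⟨1, one_pos, 1, fun _ _ => Or.inl (Set.encard_le_one_iff.2 fun a b _ _ => Subsingleton.elim a b)⟩

/-! ### Unary definable sets -/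

section Unary

theorem IsAffine.exists_finite_forall_eq_zero_iff {G : Type*} [AddCommGroup G] [IsAddTorsionFree G]
    {t : (Option Empty → G) → G} (ht : IsAffine t) {n : ℕ} (hn : n ≠ 0) :
    ∃ B : Set G, B.Finite ∧ ∀ y ∉ B, ∀ z ∉ B, (t fun _ => n • y) = 0 ↔ (t fun _ => n • z) = 0 := by
  obtain ⟨k, E, -, htk⟩ := ht.exists_eq_zsmul_add
  have hvalue : ∀ x : G, (t fun _ => x) = k • x + E Empty.elim := fun x => by
    rw [← htk]
    exact congrArg t (funext fun o => o.rec rfl fun i => i.elim)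
  simp only [hvalue]
  by_cases hk : k = 0
  · exact ⟨∅, Set.finite_empty, fun y _ z _ => by simp only [hk, zero_smul]⟩
  · refine ⟨{y | k • n • y + E Empty.elim = 0}, Set.Subsingleton.finite fun a ha b hb => ?_,
      fun _ hy _ hz => iff_of_false hy hz⟩
    have h : k • n • a + E Empty.elim = k • n • b + E Empty.elim := ha.trans hb.symm
    rwa [add_left_inj, smul_right_inj hk, smul_right_inj hn] at h

theorem finite_or_finite_compl_of_forall_notMem {X : Type*} {B E : Set X} (hB : B.Finite)
    (h : ∀ y ∉ B, ∀ z ∉ B, y ∈ E → z ∈ E) : E.Finite ∨ Eᶜ.Finite := by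
  by_cases hE : E ⊆ B
  · exact Or.inl (hB.subset hE)
  · obtain ⟨y, hyE, hyB⟩ := Set.not_subset.1 hE
    exact Or.inr (hB.subset fun z hz => by_contra fun hzB => hz (h y hyB z hzB hyE))

theorem DefinableRel.exists_nsmul_finite_or_finite_compl {G : Type*} [AddCommGroup G]
    [IsAddTorsionFree G] [Infinite G] {D : Set G}
    (h : DefinableRel groupLang fun v : Unit → G => v () ∈ D) :
    ∃ n : ℕ, 0 < n ∧ ({y | n • y ∈ D}.Finite ∨ {y | n • y ∈ D}ᶜ.Finite) := by
  have hD : DefinableRel groupLang fun v : Option Empty → G => v none ∈ D :=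
    h.relabel fun _ => none
  obtain ⟨T, hT, hA, n, hn, hdet⟩ := hD.determinedBy_eq_zero eliminates_eq_zero
  choose! B hB hconst using fun t ht => (hA t ht).exists_finite_forall_eq_zero_iff hn.ne'
  refine ⟨n, hn, finite_or_finite_compl_of_forall_notMem (hT.biUnion hB) fun y hy z hz => ?_⟩
  simp only [Set.mem_iUnion, not_exists] at hy hz
  exact hdet (fun _ => n • y) (fun _ => n • z)
    (fun t ht => propext (hconst t ht y (hy t ht) z (hz t ht))) fun _ => ⟨z - y, by module⟩

theorem DefinableRel.mem_of_finite_or_finite_compl {L : FirstOrder.Language} {G α : Type*}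
    [L.Structure G] {S : Set G} (hS : S.Finite ∨ Sᶜ.Finite) (i : α) :
    DefinableRel L fun v : α → G => v i ∈ S := by
  have hfinite : ∀ S : Set G, S.Finite → DefinableRel L fun v : α → G => v i ∈ S := by
    intro S hS
    have : Finite S := hS
    have h : DefinableRel L fun v : α → G => ∃ s : S, v i = s :=
      CoDefinable.finite_exists fun s =>
        CoDefinable.eq (CoDefinableFun.proj i) (DefinableMap.const (s : G))
    simpa only [Subtype.exists, exists_prop, exists_eq_right'] using h
  rcases hS with hS | hS
  · exact hfinite S hS
  · simpa only [Set.mem_compl_iff, not_not] using (hfinite _ hS).not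

theorem definable₁_of_finite_or_finite_compl {G : Type*} [AddCommGroup G] {n k : ℕ}
    (hreps : HasCosetReps G n k) {D : Set G}
    (h : ∀ c, {y | c + n • y ∈ D}.Finite ∨ {y | c + n • y ∈ D}ᶜ.Finite) :
    (Set.univ : Set G).Definable₁ groupLang D := by
  obtain ⟨r, hr⟩ := hreps
  have hadd := addCoDefinable_groupLang (id : G → G) (id : G → G)
  have hcosets : DefinableRel groupLang fun v : Unit → G =>
      ∃ i : Fin k, ∃ y, v () = r i + n • y ∧ y ∈ {y | r i + n • y ∈ D} :=
    CoDefinable.finite_exists fun i => CoDefinable.exists (CoDefinable.and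
      (CoDefinable.eq (CoDefinableFun.proj (some ())) ((DefinableMap.const (r i)).add hadd
        ((CoDefinableFun.proj none).nsmul hadd n)))
      (DefinableRel.mem_of_finite_or_finite_compl (h (r i)) none))
  have hD : ∀ v : Unit → G,
      (∃ i : Fin k, ∃ y, v () = r i + n • y ∧ y ∈ {y | r i + n • y ∈ D}) ↔ v () ∈ D := by
    refine fun v => ⟨?_, fun hv => ?_⟩
    · rintro ⟨i, y, hy, hyD⟩
      rwa [hy]
    · obtain ⟨i, y, hy⟩ := hr (v ())
      exact ⟨i, y, hy, by rwa [hy] at hv⟩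
  exact definable₁_iff_definableRel.2 (hcosets.congr hD hD)

variable {L : FirstOrder.Language} {G : Type*} [L.Structure G] [AddCommGroup G]

theorem UniformlySmall.noNewUnarySets (h : UniformlySmall L G) (hG : HasSmallQuotients G) :
    NoNewUnarySets groupLang L G := by
  intro D hD
  obtain ⟨n, hn, k, hk⟩ := h (fun _ : Empty → G => D)
    ((definable₁_iff_definableRel.1 hD).relabel fun _ => none)
  obtain ⟨l, hreps⟩ := hasSmallQuotients_iff_hasCosetReps.1 hG n hn
  exact definable₁_of_finite_or_finite_compl hreps fun c =>
    (hk Empty.elim c).imp Set.finite_of_encard_le_coe Set.finite_of_encard_le_coe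

variable [LinearOrder G] {𝒢 : Type*} [AddCommGroup 𝒢] [LinearOrder 𝒢]

theorem map_nsmul_of_elementaryEmbedding (f : G ↪ₑ[ordGroupLang] 𝒢) (n : ℕ) (y : G) :
    f (n • y) = n • f y :=
  map_nsmul (AddMonoidHom.mk' f fun x y => f.map_fun (L := ordGroupLang) PlusFunc.add ![x, y]) n y

theorem DefinableRel.exists_nsmul_finite_or_finite_compl_of_interprets [L.Structure 𝒢]
    [IsAddTorsionFree 𝒢] [Infinite 𝒢] (f : G ↪ₑ[ordGroupLang] 𝒢)
    (H : Interprets L ordGroupLang (id : G → G) f) (h : NoNewUnarySets groupLang L 𝒢) {D : Set G}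
    (hD : DefinableRel L fun v : Unit → G => v () ∈ D) :
    ∃ n : ℕ, 0 < n ∧ ({y | n • y ∈ D}.Finite ∨ {y | n • y ∈ D}ᶜ.Finite) := by
  obtain ⟨𝒟, h𝒟, hpreimage⟩ := hD.exists_preimage_eq H
  obtain ⟨n, hn, hfin⟩ := (definable₁_iff_definableRel.1
    (h 𝒟 (definable₁_iff_definableRel.2 h𝒟))).exists_nsmul_finite_or_finite_compl
  have hnsmul : f ⁻¹' {x | n • x ∈ 𝒟} = {y | n • y ∈ D} := by
    rw [← hpreimage]
    ext y
    rw [Set.mem_preimage, Set.mem_ofPred_eq, Set.mem_ofPred_eq, Set.mem_preimage,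
      map_nsmul_of_elementaryEmbedding]
  refine ⟨n, hn, ?_⟩
  rw [← hnsmul, ← Set.preimage_compl]
  exact hfin.imp (·.preimage f.injective.injOn) (·.preimage f.injective.injOn)

theorem UniformlySmall.of_interprets [L.Structure 𝒢] (h : UniformlySmall L G)
    {f : G ↪ₑ[ordGroupLang] 𝒢} (H : Interprets L ordGroupLang (id : G → G) f) :
    UniformlySmall L 𝒢 := by
  intro β _ S hS
  obtain ⟨m, b, φ, hφ⟩ := hS.exists_params
  obtain ⟨n, hn, k, hk⟩ := h _ (DefinableFamily.of_formula φ)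
  have hQ := (H.coDefinableFamily φ).affine_preimage (addCoDefinable_ordGroupLang id f) n
  have hsmall := (hQ.encard_le k).or (hQ.compl.encard_le k)
  refine ⟨n, hn, k, fun v c => ?_⟩
  rw [← hφ v]
  exact hsmall.forall_iff_of_elementaryEmbedding.1 (fun w => hk _ (w none))
    (Option.elim · c (Sum.elim b v))

end Unary

section Equivalence

variable {L : FirstOrder.Language} {G : Type*} [L.Structure G] [AddCommGroup G] [LinearOrder G]
  [IsOrderedAddMonoid G]

theorem UniformlySmall.of_stable_or_noNewUnarySets (hr : IsRegularGroup G)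
    (hMN : IsReductOver (Set.univ : Set G) L ordGroupLang)
    (hGM : IsReductOver (Set.univ : Set G) groupLang L)
    {𝒢 : Type*} [AddCommGroup 𝒢] [LinearOrder 𝒢] [IsOrderedAddMonoid 𝒢] [L.Structure 𝒢]
    {f : G ↪ₑ[ordGroupLang] 𝒢} (H : Interprets L ordGroupLang (id : G → G) f)
    (h : IsStableStructure L G ∨ NoNewUnarySets groupLang L G ∨ NoNewUnarySets groupLang L 𝒢) :
    UniformlySmall L G := by
  rcases subsingleton_or_nontrivial G with _ | _
  · exact UniformlySmall.of_subsingleton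
  have : Nontrivial 𝒢 := f.injective.nontrivial
  suffices hmin : IsSignMinimal L G from hmin.uniformlySmall hGM.addCoDefinable hMN.interprets_id hr
  rcases h with h | h | h
  · exact h.isSignMinimal hGM.addCoDefinable hr
  · exact isSignMinimal_of_nsmul hr fun D hD =>
      DefinableRel.exists_nsmul_finite_or_finite_compl
        (definable₁_iff_definableRel.1 (h D (definable₁_iff_definableRel.2 hD)))
  · exact isSignMinimal_of_nsmul hr fun D hD =>
      DefinableRel.exists_nsmul_finite_or_finite_compl_of_interprets f H h hD

theorem mainTheorem5_general (hr : IsRegularGroup G) (hG : HasSmallQuotients G)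
    (hMN : IsReductOver (Set.univ : Set G) L ordGroupLang)
    (hGM : IsReductOver (Set.univ : Set G) groupLang L)
    {𝒢 : Type*} [AddCommGroup 𝒢] [LinearOrder 𝒢] [IsOrderedAddMonoid 𝒢]
    (f : G ↪ₑ[ordGroupLang] 𝒢) :
    List.TFAE [
      IsStableStructure L G,
      NoNewUnarySets groupLang L G,
      @NoNewUnarySets groupLang L 𝒢 _ (reductStructure L f)] := by
  let _ := reductStructure L f
  have H : Interprets L ordGroupLang (id : G → G) f := hMN.interprets_reductStructure f
  have hsmall := UniformlySmall.of_stable_or_noNewUnarySets hr hMN hGM H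
  have h𝒢 : HasSmallQuotients 𝒢 := hG.of_elementarilyEquivalent f.elementarilyEquivalent.symm
  tfae_have 1 → 2 := fun h => (hsmall (.inl h)).noNewUnarySets hG
  tfae_have 2 → 3 := fun h => ((hsmall (.inr (.inl h))).of_interprets H).noNewUnarySets h𝒢
  tfae_have 3 → 1 := fun h => (hsmall (.inr (.inr h))).isStableStructure hGM.addCoDefinable hG
  tfae_finish

end Equivalence

theorem mainTheorem5
    -- an archimedean ordered abelian group with small quotients
    {H : Type*} [AddCommGroup H] [LinearOrder H] [IsOrderedAddMonoid H] [Archimedean H]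
    (hH : HasSmallQuotients H)
    -- `N = (G, +, <)`, elementarily equivalent to it
    {G : Type*} [AddCommGroup G] [LinearOrder G] [IsOrderedAddMonoid G]
    (hGH : G ≅[ordGroupLang] H)
    -- `M`, an `L`-structure on `G` which is a reduct of `N` and an expansion of `(G, +)`
    (L : FirstOrder.Language) [L.Structure G]
    (hMN : IsReductOver (Set.univ : Set G) L ordGroupLang)
    (hGM : IsReductOver (Set.univ : Set G) groupLang L)
    -- `𝒩 = (𝒢, +, <)`, a monster model of the theory of `N`, with `N` as a small elementary submodel
    {𝒢 : Type*} [AddCommGroup 𝒢] [LinearOrder 𝒢] [IsOrderedAddMonoid 𝒢]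
    (f : G ↪ₑ[ordGroupLang] 𝒢) (κ : Cardinal)
    (hκ : IsMonsterModel κ ordGroupLang 𝒢) (hsmall : #(Set.range f) < κ) :
    List.TFAE [
      IsStableStructure L G,
      NoNewUnarySets groupLang L G,
      -- the reduct of `𝒩` to the language of `M`
      @NoNewUnarySets groupLang L 𝒢 _ (reductStructure L f)] := by
  exact mainTheorem5_general ((isRegularGroup_of_archimedean H).of_elementarilyEquivalent hGH)
    (hH.of_elementarilyEquivalent hGH) hMN hGM f
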